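/- Let $\mathbb K$ be an algebraically closed field of characteristic zero, $x=(x_1,\dots,x_N)$, $y=(y_1,\dots,y_M)$, and let $\omega\in\mathbb R^N$ have rationally independent coordinates. \textbf{Series.} Let $S_\omega$ be the ring (in fact a field) of $\omega$-positive Puiseux series: formal series $\varphi=\sum_{\alpha\in\mathbb Q^N}c_\alpha x^\alpha$, $c_\alpha\in\mathbb K$, whose set of exponents $\{\alpha\mid c_\alpha\ne0\}$ is contained in $\frac1k\mathbb Z^N$ for some integer $k\ge1$ and, for some $\gamma\in\mathbb Q^N$, is mapped by $\alpha\mapsto\alpha+\gamma$ into a cone generated by finitely many rational vectors on which $\omega\cdot v\ge 0$. For $\varphi\neq0$ let $\operatorname{ord}_\omega\varphi=\min\{\omega\cdot\alpha\mid c_\alpha\neq0\}$ and let the first term $\operatorname{in}_\omega\varphi$ be $c_\alpha x^\alpha$ for the unique $\alpha$ attaining this minimum; put $\operatorname{ord}_\omega0=\infty$, $\operatorname{in}_\omega0=0$. Both are applied coordinatewise to elements of $S_\omega^M$. \textbf{Ideals.} Write $\mathbb K[x^*,y]=\mathbb K[x_1^{\pm1},\dots,x_N^{\pm1},y_1,\dots,y_M]$.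 An ideal $I\subset\mathbb K[x^*,y]$ is $N$-admissible if the projection $V(I\cap\mathbb K[x,y])\to\mathbb K^N$, $(x,y)\mapsto x$, of the zero set in $\mathbb K^{N+M}$ is dominant with finite generic fibre. An $\omega$-solution of an ideal $I\subset \mathbb K[x^*,y]$ is a common zero in $S_\omega^M$ of the extension of $I$ to $S_\omega[y]$. \textbf{Initial ideals.} Let $\omega\in\mathbb R^N$ be arbitrary here, and $\eta\in(\mathbb R\cup\{\infty\})^M$, with $\infty\cdot0=0$ and $\infty\cdot n=\infty$ for $n>0$. For $f=\sum a_{\alpha,\beta}x^\alpha y^\beta\in\mathbb K[x^*,y]$ let $m$ be the minimum of $\omega\cdot\alpha+\eta\cdot\beta$ over $a_{\alpha,\beta}\ne0$ ($m=\infty$ if $f=0$); let $\operatorname{In}_{\omega,\eta}f$ be the sum of the terms $a_{\alpha,\beta}x^\alpha y^\beta$ with $\omega\cdot\alpha+\eta\cdot\beta=m$ if $m<\infty$, and $0$ if $m=\infty$. Let $\operatorname{In}_{\omega,\eta}I$ be the ideal of $\mathbb K[x^*,y]$ generated by $\{\operatorname{In}_{\omega,\eta}f\mid f\in I\}\cup\{y_j\mid\eta_j=\infty\}$.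 The tropical variety of $I$ is the set of all $(\omega,\eta)\in\mathbb R^N\times(\mathbb R\cup\{\infty\})^M$ such that $\operatorname{In}_{\omega,\eta}I$ contains no monomial $a\,x^\alpha y^\beta$, $a\in\mathbb K\setminus\{0\}$, involving only the variables $x_i$ and those $y_j$ with $\eta_j\neq\infty$. \textbf{Theorem.} Let $I\subset\mathbb K[x^*,y]$ be an $N$-admissible ideal and let $\omega\in\mathbb R^N$ have rationally independent coordinates. Let $\phi=(c_1x^{\alpha^{(1)}},\dots,c_Mx^{\alpha^{(M)}})$ with $c_j\in\mathbb K$ (possibly $0$) and $\alpha^{(j)}\in\mathbb Q^N$. Then there is an $\omega$-solution $\psi\in S_\omega^M$ of $I$ with $\operatorname{in}_\omega\psi=\phi$ if and only if \begin{itemize} \item $(\omega,\operatorname{ord}_\omega\phi)$ lies in the tropical variety of $I$, and \item $\phi$ is an $\omega$-solution of the initial ideal $\operatorname{In}_{\omega,\operatorname{ord}_\omega\phi}I$. \end{itemize} -/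

import Mathlib

noncomputable section

namespace OmegaPuiseux

/-! ## Exponents, ordered by a weight vector -/

/-- The group `ℚ^N` of exponents, to be ordered by the weight vector `ω`. -/
def Expo {N : ℕ} (_ω : Fin N → ℝ) : Type := Fin N → ℚ

/-- The pairing `ω · α` of a real weight vector with a rational exponent. -/
def pairing {N : ℕ} (ω : Fin N → ℝ) (α : Fin N → ℚ) : ℝ := ∑ i, ω i * (α i : ℝ)

theorem pairing_add {N : ℕ} (ω : Fin N → ℝ) (α β : Fin N → ℚ) :
    pairing ω (α + β) = pairing ω α + pairing ω β := by
  simp [pairing, mul_add, Finset.sum_add_distrib]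

theorem pairing_injective {N : ℕ} {ω : Fin N → ℝ} (hω : LinearIndependent ℚ ω) :
    Function.Injective (pairing ω) := by
  intro α β h
  have h2 : ∑ i, (α i - β i) • ω i = 0 := by
    simp only [pairing] at h
    simp only [sub_smul, Finset.sum_sub_distrib, Rat.smul_def]
    simp only [mul_comm (ω _)] at h
    linarith
  have h3 := Fintype.linearIndependent_iff.1 hω (fun i => α i - β i) h2
  funext i
  linarith [h3 i]

instance {N : ℕ} (ω : Fin N → ℝ) : AddCommGroup (Expo ω) :=
  inferInstanceAs (AddCommGroup (Fin N → ℚ))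

/-- The identity map, viewing a vector of `ℚ^N` as an exponent. -/
def Expo.of {N : ℕ} (ω : Fin N → ℝ) : (Fin N → ℚ) ≃+ Expo ω := AddEquiv.refl _

/-- The `ω`-weight `ω · α` of an exponent. -/
def Expo.wt {N : ℕ} {ω : Fin N → ℝ} (α : Expo ω) : ℝ := pairing ω ((Expo.of ω).symm α)

theorem Expo.wt_add {N : ℕ} {ω : Fin N → ℝ} (α β : Expo ω) :
    (α + β).wt = α.wt + β.wt := by
  simp only [Expo.wt, map_add, pairing_add]

theorem Expo.wt_injective {N : ℕ} {ω : Fin N → ℝ} (hω : LinearIndependent ℚ ω) :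
    Function.Injective (Expo.wt (ω := ω)) :=
  (pairing_injective hω).comp (Expo.of ω).symm.injective

/-- `α ≤ β` iff `α = β` or `ω · α < ω · β`.  When the coordinates of `ω` are rationally
independent this is the total order `α ≤ β ↔ ω · α ≤ ω · β`, see `Expo.le_iff`. -/
instance {N : ℕ} (ω : Fin N → ℝ) : PartialOrder (Expo ω) where
  le α β := α = β ∨ α.wt < β.wt
  le_refl _ := Or.inl rfl
  le_trans := by
    rintro α β γ (rfl | h) (rfl | h')
    · exact Or.inl rfl
    · exact Or.inr h'
    · exact Or.inr h
    · exact Or.inr (h.trans h')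
  le_antisymm := by
    rintro α β (rfl | h) (h' | h')
    · rfl
    · rfl
    · exact h'.symm
    · exact absurd h (not_lt.2 h'.le)

theorem Expo.le_iff {N : ℕ} {ω : Fin N → ℝ} (hω : LinearIndependent ℚ ω) (α β : Expo ω) :
    α ≤ β ↔ α.wt ≤ β.wt := by
  refine Iff.trans (b := α = β ∨ α.wt < β.wt) Iff.rfl ?_
  rw [le_iff_lt_or_eq, or_comm]
  exact or_congr Iff.rfl (Expo.wt_injective hω).eq_iff.symm

instance {N : ℕ} (ω : Fin N → ℝ) : IsOrderedAddMonoid (Expo ω) where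
  add_le_add_left := by
    rintro α β (rfl | h) γ
    · exact le_rfl
    · refine Or.inr ?_
      rw [Expo.wt_add, Expo.wt_add]
      linarith

/-! ## Puiseux series with exponents in a translate of an `ω`-positive rational cone -/

/-- The inclusion of `ℚ^N` in `ℝ^N`. -/
def toRealVec {N : ℕ} (α : Fin N → ℚ) : Fin N → ℝ := fun i => (α i : ℝ)

/-- The convex rational polyhedral cone generated by finitely many vectors of `ℚ^N`. -/
def rationalCone {N : ℕ} (s : Finset (Fin N → ℚ)) : PointedCone ℝ (Fin N → ℝ) :=
  PointedCone.hull ℝ (toRealVec '' (s : Set (Fin N → ℚ)))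

/-- A cone is `ω`-positive when `ω · v ≥ 0` for every `v` in it. -/
def IsPositiveCone {N : ℕ} (ω : Fin N → ℝ) (σ : PointedCone ℝ (Fin N → ℝ)) : Prop :=
  ∀ v ∈ σ, 0 ≤ ω ⬝ᵥ v

/-- A set of exponents contained in a lattice `(1/k) ℤ^N`. -/
def InLattice {N : ℕ} (E : Set (Fin N → ℚ)) : Prop :=
  ∃ k : ℕ, 0 < k ∧ ∀ α ∈ E, ∀ i, ∃ m : ℤ, α i = (m : ℚ) / k

/-- A set of exponents some translate of which is contained in an `ω`-positive rational cone. -/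
def InTranslatedCone {N : ℕ} (ω : Fin N → ℝ) (E : Set (Fin N → ℚ)) : Prop :=
  ∃ (γ : Fin N → ℚ) (s : Finset (Fin N → ℚ)), IsPositiveCone ω (rationalCone s) ∧
    ∀ α ∈ E, toRealVec (α + γ) ∈ rationalCone s

/-- The condition on the set of exponents of an `ω`-positive Puiseux series. -/
def IsPositivePuiseux {N : ℕ} (ω : Fin N → ℝ) (E : Set (Fin N → ℚ)) : Prop :=
  InLattice E ∧ InTranslatedCone ω E

theorem toRealVec_add {N : ℕ} (α β : Fin N → ℚ) :
    toRealVec (α + β) = toRealVec α + toRealVec β := by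
  funext i; simp [toRealVec]

theorem dotProduct_toRealVec {N : ℕ} (ω : Fin N → ℝ) (α : Fin N → ℚ) :
    ω ⬝ᵥ toRealVec α = pairing ω α := rfl

theorem isPositiveCone_iff {N : ℕ} (ω : Fin N → ℝ) (s : Finset (Fin N → ℚ)) :
    IsPositiveCone ω (rationalCone s) ↔ ∀ v ∈ s, 0 ≤ pairing ω v := by
  constructor
  · intro h v hv
    exact h _ (Submodule.subset_span ⟨v, hv, rfl⟩)
  · intro h v hv
    induction hv using Submodule.span_induction with
    | mem x hx =>
      obtain ⟨v, hv, rfl⟩ := hx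
      exact h v hv
    | zero => simp
    | add x y _ _ hx hy => rw [dotProduct_add]; exact add_nonneg hx hy
    | smul a x _ hx =>
      have : a • x = (a : ℝ) • x := rfl
      rw [this, dotProduct_smul]
      exact mul_nonneg a.2 hx

theorem rationalCone_mono {N : ℕ} {s t : Finset (Fin N → ℚ)} (h : s ⊆ t) :
    rationalCone s ≤ rationalCone t :=
  Submodule.span_mono (Set.image_mono (by exact_mod_cast h))

theorem InLattice.add {N : ℕ} {E F : Set (Fin N → ℚ)} (hE : InLattice E) (hF : InLattice F) :
    ∃ k : ℕ, 0 < k ∧ (∀ α ∈ E, ∀ i, ∃ m : ℤ, α i = (m : ℚ) / k) ∧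
      (∀ α ∈ F, ∀ i, ∃ m : ℤ, α i = (m : ℚ) / k) := by
  obtain ⟨k, hk, h⟩ := hE
  obtain ⟨l, hl, h'⟩ := hF
  have hk' : (k : ℚ) ≠ 0 := by positivity
  have hl' : (l : ℚ) ≠ 0 := by positivity
  refine ⟨k * l, Nat.mul_pos hk hl, fun α hα i => ?_, fun α hα i => ?_⟩
  · obtain ⟨m, hm⟩ := h α hα i
    exact ⟨m * l, by rw [hm]; push_cast; field_simp⟩
  · obtain ⟨m, hm⟩ := h' α hα i
    exact ⟨m * k, by rw [hm]; push_cast; field_simp⟩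

open scoped Pointwise in
theorem IsPositivePuiseux.add {N : ℕ} {ω : Fin N → ℝ} {E F : Set (Fin N → ℚ)}
    (hE : IsPositivePuiseux ω E) (hF : IsPositivePuiseux ω F) :
    IsPositivePuiseux ω (E + F) := by
  classical
  obtain ⟨k, hk, h1, h2⟩ := hE.1.add hF.1
  obtain ⟨-, γ, s, hs, hsE⟩ := hE
  obtain ⟨-, δ, t, ht, htF⟩ := hF
  refine ⟨⟨k, hk, ?_⟩, γ + δ, s ∪ t, ?_, ?_⟩
  · rintro _ ⟨α, hα, β, hβ, rfl⟩ i
    obtain ⟨m, hm⟩ := h1 α hα i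
    obtain ⟨n, hn⟩ := h2 β hβ i
    exact ⟨m + n, by simp only [Pi.add_apply, hm, hn]; push_cast; ring⟩
  · rw [isPositiveCone_iff] at *
    intro v hv
    rcases Finset.mem_union.1 hv with h | h
    exacts [hs v h, ht v h]
  · rintro _ ⟨α, hα, β, hβ, rfl⟩
    have : toRealVec (α + β + (γ + δ)) = toRealVec (α + γ) + toRealVec (β + δ) := by
      rw [← toRealVec_add]; congr 1; abel
    change toRealVec (α + β + (γ + δ)) ∈ _
    rw [this]
    exact add_mem (rationalCone_mono Finset.subset_union_left (hsE α hα))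
      (rationalCone_mono Finset.subset_union_right (htF β hβ))

theorem IsPositivePuiseux.mono {N : ℕ} {ω : Fin N → ℝ} {E F : Set (Fin N → ℚ)}
    (hF : IsPositivePuiseux ω F) (h : E ⊆ F) : IsPositivePuiseux ω E := by
  obtain ⟨⟨k, hk, h1⟩, γ, s, hs, h2⟩ := hF
  exact ⟨⟨k, hk, fun α hα => h1 α (h hα)⟩, γ, s, hs, fun α hα => h2 α (h hα)⟩

theorem IsPositivePuiseux.union {N : ℕ} {ω : Fin N → ℝ} {E F : Set (Fin N → ℚ)}
    (hE : IsPositivePuiseux ω E) (hF : IsPositivePuiseux ω F) :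
    IsPositivePuiseux ω (E ∪ F) := by
  classical
  wlog hle : pairing ω (hF.2.choose) ≤ pairing ω (hE.2.choose) generalizing E F
  · rw [Set.union_comm]
    exact this hF hE (le_of_not_ge hle)
  obtain ⟨k, hk, h1, h2⟩ := hE.1.add hF.1
  refine ⟨⟨k, hk, fun α hα => hα.elim (h1 α) (h2 α)⟩, ?_⟩
  obtain ⟨s, hs, hsE⟩ := hE.2.choose_spec
  obtain ⟨t, ht, htF⟩ := hF.2.choose_spec
  set γ := hE.2.choose
  set δ := hF.2.choose
  have hd : 0 ≤ pairing ω (γ - δ) := by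
    have := pairing_add ω (γ - δ) δ
    rw [sub_add_cancel] at this
    linarith
  refine ⟨γ, insert (γ - δ) (s ∪ t), ?_, ?_⟩
  · rw [isPositiveCone_iff] at *
    intro v hv
    rcases Finset.mem_insert.1 hv with rfl | hv
    · exact hd
    rcases Finset.mem_union.1 hv with h | h
    exacts [hs v h, ht v h]
  · rintro α (hα | hα)
    · exact rationalCone_mono
        (Finset.subset_union_left.trans (Finset.subset_insert _ _)) (hsE α hα)
    · have : toRealVec (α + γ) = toRealVec (α + δ) + toRealVec (γ - δ) := by
        rw [← toRealVec_add]; congr 1; abel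
      rw [this]
      refine add_mem (rationalCone_mono
        (Finset.subset_union_right.trans (Finset.subset_insert _ _)) (htF α hα)) ?_
      exact Submodule.subset_span ⟨γ - δ, by simp, rfl⟩

theorem isPositivePuiseux_singleton {N : ℕ} (ω : Fin N → ℝ) (α : Fin N → ℚ) :
    IsPositivePuiseux ω {α} := by
  refine ⟨⟨∏ i, (α i).den, Finset.prod_pos fun i _ => (α i).den_pos, ?_⟩, -α, ∅, ?_, ?_⟩
  · intro β hβ i
    rw [Set.mem_singleton_iff.1 hβ]
    have hp : (∏ j, (α j).den) = (α i).den * ∏ j ∈ Finset.univ.erase i, (α j).den :=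
      (Finset.mul_prod_erase _ _ (Finset.mem_univ i)).symm
    refine ⟨(α i).num * ∏ j ∈ Finset.univ.erase i, ((α j).den : ℤ), ?_⟩
    have h1 : (((∏ j ∈ Finset.univ.erase i, (α j).den : ℕ)) : ℚ) ≠ 0 := by
      exact_mod_cast Finset.prod_ne_zero_iff.2 fun j _ => (α j).den_nz
    have h2 : ((α i).den : ℚ) ≠ 0 := by exact_mod_cast (α i).den_nz
    rw [hp, eq_div_iff (by push_cast at h1 ⊢; exact mul_ne_zero h2 h1)]
    have h3 := Rat.mul_den_eq_num (α i)
    push_cast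
    rw [← mul_assoc, h3]
  · rw [isPositiveCone_iff]; simp
  · intro β hβ
    rw [Set.mem_singleton_iff.1 hβ]
    have : toRealVec (α + -α) = 0 := by funext i; simp [toRealVec]
    rw [this]
    exact zero_mem _

/-- For rationally independent `ω`, an `ω`-positive Puiseux set of exponents has finitely many
elements of bounded `ω`-weight. -/
theorem IsPositivePuiseux.finite_le {N : ℕ} {ω : Fin N → ℝ} (hω : LinearIndependent ℚ ω)
    {E : Set (Fin N → ℚ)} (hE : IsPositivePuiseux ω E) (C : ℝ) :
    {α ∈ E | pairing ω α ≤ C}.Finite := by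
  obtain ⟨⟨k, hk, hl⟩, γ, s, hs, hc⟩ := hE
  rw [isPositiveCone_iff] at hs
  -- every coordinate is bounded on the cone by a multiple of the weight
  have hb : ∃ B : ℝ, 0 ≤ B ∧ ∀ v ∈ rationalCone s, ∀ i, |v i| ≤ B * (ω ⬝ᵥ v) := by
    have hpos : ∀ v ∈ s, v ≠ 0 → 0 < pairing ω v := by
      intro v hv hv0
      refine lt_of_le_of_ne (hs v hv) fun h => hv0 (pairing_injective hω ?_)
      rw [← h]; simp [pairing]
    refine ⟨∑ v ∈ s, (∑ i, |(v i : ℝ)|) / pairing ω v, Finset.sum_nonneg fun v hv =>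
      div_nonneg (Finset.sum_nonneg fun _ _ => abs_nonneg _) (hs v hv), fun v hv i => ?_⟩
    induction hv using Submodule.span_induction with
    | mem x hx =>
      obtain ⟨v, hv, rfl⟩ := hx
      rw [dotProduct_toRealVec]
      by_cases hv0 : v = 0
      · subst hv0; simp [toRealVec, pairing]
      have hp := hpos v hv hv0
      calc |toRealVec v i| ≤ ∑ i, |(v i : ℝ)| :=
            Finset.single_le_sum (f := fun i => |(v i : ℝ)|)
              (fun _ _ => abs_nonneg _) (Finset.mem_univ i)
        _ = (∑ i, |(v i : ℝ)|) / pairing ω v * pairing ω v := by field_simp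
        _ ≤ _ := by
            refine mul_le_mul_of_nonneg_right ?_ hp.le
            exact Finset.single_le_sum (f := fun v => (∑ i, |(v i : ℝ)|) / pairing ω v)
              (fun v hv => div_nonneg (Finset.sum_nonneg fun _ _ => abs_nonneg _) (hs v hv)) hv
    | zero => simp
    | add x y _ _ hx hy =>
      rw [dotProduct_add, mul_add]
      exact (abs_add_le _ _).trans (add_le_add hx hy)
    | smul a x _ hx =>
      have : a • x = (a : ℝ) • x := rfl
      rw [this, dotProduct_smul, Pi.smul_apply, smul_eq_mul, smul_eq_mul, abs_mul,
        abs_of_nonneg a.2]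
      calc (a : ℝ) * |x i| ≤ a * (_ * (ω ⬝ᵥ x)) := mul_le_mul_of_nonneg_left hx a.2
        _ = _ := by ring
  obtain ⟨B, hB, hb⟩ := hb
  obtain ⟨R, hR⟩ := exists_nat_ge (∑ i, (k : ℝ) * (B * (C + pairing ω γ) + |(γ i : ℝ)|))
  refine ((Set.Finite.pi' (fun _ : Fin N => Set.finite_Icc (-((R + 1 : ℕ) : ℤ) - 1)
    ((R + 1 : ℕ) : ℤ))).image (fun m : Fin N → ℤ => fun i => (m i : ℚ) / k)).subset ?_
  rintro α ⟨hα, hαC⟩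
  choose m hm using hl α hα
  have hkR : (0 : ℝ) < k := by exact_mod_cast hk
  have hw : 0 ≤ C + pairing ω γ := by
    have h0 := (isPositiveCone_iff ω s).2 hs _ (hc α hα)
    rw [dotProduct_toRealVec, pairing_add] at h0
    linarith
  refine ⟨m, fun i => ?_, by funext i; exact (hm i).symm⟩
  have h1 := hb _ (hc α hα) i
  rw [dotProduct_toRealVec, pairing_add] at h1
  have h2 : |(α i : ℝ)| ≤ B * (C + pairing ω γ) + |(γ i : ℝ)| := by
    have e : (α i : ℝ) = toRealVec (α + γ) i - (γ i : ℝ) := by simp [toRealVec]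
    rw [e]
    refine (abs_sub _ _).trans (add_le_add (h1.trans ?_) le_rfl)
    exact mul_le_mul_of_nonneg_left (by linarith) hB
  have h3 : |(m i : ℝ)| ≤ R := by
    have e : (m i : ℝ) = k * (α i : ℝ) := by
      rw [hm i]; push_cast; field_simp
    rw [e, abs_mul, abs_of_pos hkR]
    refine (mul_le_mul_of_nonneg_left h2 hkR.le).trans (le_trans ?_ hR)
    exact Finset.single_le_sum
      (f := fun i => (k : ℝ) * (B * (C + pairing ω γ) + |(γ i : ℝ)|))
      (fun i _ => mul_nonneg hkR.le (add_nonneg (mul_nonneg hB hw) (abs_nonneg _)))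
      (Finset.mem_univ i)
  rw [abs_le] at h3
  have h4 : -(R : ℤ) ≤ m i := by exact_mod_cast h3.1
  have h5 : m i ≤ (R : ℤ) := by exact_mod_cast h3.2
  constructor <;> push_cast <;> linarith

/-- For rationally independent `ω`, an `ω`-positive Puiseux set of exponents is well-ordered, so
that the support condition of Hahn series is no restriction on `ω`-positive Puiseux series. -/
theorem IsPositivePuiseux.isPWO {N : ℕ} {ω : Fin N → ℝ} (hω : LinearIndependent ℚ ω)
    {E : Set (Fin N → ℚ)} (hE : IsPositivePuiseux ω E) : (Expo.of ω '' E).IsPWO := by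
  intro f
  by_contra! hcon
  have hlt : ∀ m n, m < n → (f n).1.wt < (f m).1.wt := by
    intro m n hmn
    by_contra! hle
    exact hcon m n hmn ((Expo.le_iff hω _ _).2 hle)
  have hinj : Function.Injective fun n => (Expo.of ω).symm (f n).1 := by
    intro m n hmn
    have hmn' : (f m).1.wt = (f n).1.wt := congrArg (pairing ω) hmn
    rcases lt_trichotomy m n with h | h | h
    · exact absurd (hlt m n h) (by rw [hmn']; exact lt_irrefl _)
    · exact h
    · exact absurd (hlt n m h) (by rw [hmn']; exact lt_irrefl _)
  have hfin := hE.finite_le hω (f 0).1.wt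
  refine Set.infinite_range_of_injective hinj (hfin.subset ?_)
  rintro _ ⟨n, rfl⟩
  refine ⟨?_, ?_⟩
  · obtain ⟨α, hα, h⟩ := (f n).2
    simpa [← h] using hα
  · rcases Nat.eq_zero_or_pos n with rfl | h
    · exact le_rfl
    · exact (hlt 0 n h).le

/-- The set of exponents `α ∈ ℚ^N` of a series. -/
def exponents {K : Type*} [Field K] {N : ℕ} {ω : Fin N → ℝ} (f : HahnSeries (Expo ω) K) :
    Set (Fin N → ℚ) :=
  {α | f.coeff (Expo.of ω α) ≠ 0}

theorem isPositivePuiseux_single {K : Type*} [Field K] {N : ℕ} (ω : Fin N → ℝ) (α : Fin N → ℚ)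
    (c : K) : IsPositivePuiseux ω (exponents (HahnSeries.single (Expo.of ω α) c)) := by
  refine (isPositivePuiseux_singleton ω α).mono fun β hβ => ?_
  by_contra h
  exact hβ (HahnSeries.coeff_single_of_ne fun h' => h ((Expo.of ω).injective h'))

/-- The ring `S_ω` of `ω`-positive Puiseux series with coefficients in `K`: the formal series
`∑ c_α x^α`, `α ∈ ℚ^N`, whose exponents lie in a lattice `(1/k) ℤ^N` and in a translate of an
`ω`-positive rational cone. -/
def SOmega (K : Type*) [Field K] {N : ℕ} (ω : Fin N → ℝ) :
    Subalgebra K (HahnSeries (Expo ω) K) where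
  carrier := {f | IsPositivePuiseux ω (exponents f)}
  mul_mem' {f g} hf hg := by
    refine (hf.add hg).mono fun α hα => ?_
    obtain ⟨β, hβ, γ, hγ, h⟩ := HahnSeries.support_mul_subset ((HahnSeries.mem_support _ _).2 hα)
    refine ⟨(Expo.of ω).symm β, ?_, (Expo.of ω).symm γ, ?_, ?_⟩
    · simpa [exponents] using hβ
    · simpa [exponents] using hγ
    · apply (Expo.of ω).injective
      simpa using h
  add_mem' {f g} hf hg := by
    refine (hf.union hg).mono fun α hα => ?_
    by_contra h
    simp only [exponents, Set.mem_union, Set.mem_ofPred_eq, not_or, not_not] at h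
    exact hα (by rw [HahnSeries.coeff_add, h.1, h.2, add_zero])
  algebraMap_mem' r := isPositivePuiseux_single ω 0 r

/-- For rationally independent `ω`, the elements of `S_ω` are exactly the families of coefficients
satisfying the lattice and cone conditions. -/
theorem SOmega.exists_coeff_iff {K : Type*} [Field K] {N : ℕ} {ω : Fin N → ℝ}
    (hω : LinearIndependent ℚ ω) (a : (Fin N → ℚ) → K) :
    (∃ f : SOmega K ω, ∀ α, f.1.coeff (Expo.of ω α) = a α) ↔
      IsPositivePuiseux ω (Function.support a) := by
  constructor
  · rintro ⟨f, hf⟩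
    exact f.2.mono fun α hα => by simpa [exponents, hf] using hα
  · intro h
    refine ⟨⟨⟨fun α => a ((Expo.of ω).symm α), (h.isPWO hω).mono ?_⟩, h.mono ?_⟩, fun α => ?_⟩
    · exact fun α hα => ⟨(Expo.of ω).symm α, hα, by simp⟩
    · exact fun α hα => by simpa [exponents] using hα
    · simp

variable {K : Type*} [Field K] {N M : ℕ}

/-- The monomial `c x^α` of `S_ω`. -/
def mono (ω : Fin N → ℝ) (α : Fin N → ℚ) (c : K) : SOmega K ω :=
  ⟨HahnSeries.single (Expo.of ω α) c, isPositivePuiseux_single ω α c⟩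

/-- The order of a series: the least `ω · α` over its exponents `α`, and `∞` for `0`. -/
def ordser {ω : Fin N → ℝ} (f : SOmega K ω) : WithTop ℝ :=
  f.1.orderTop.map Expo.wt

/-- The first term of a series: its term of least order, and `0` for `0`. -/
def inser {ω : Fin N → ℝ} (f : SOmega K ω) : SOmega K ω :=
  f.1.orderTop.recTopCoe 0 (fun α => mono ω ((Expo.of ω).symm α) (f.1.coeff α))

/-! ## Laurent polynomials and ideals of `K[x^*, y]` -/

/-- `K[x^*]`, the Laurent polynomials in `N` variables. -/
abbrev Laurent (K : Type*) [Field K] (N : ℕ) : Type _ := AddMonoidAlgebra K (Fin N → ℤ)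

/-- `K[x^*, y] = K[x^*][y]`, with `N` variables `x` and `M` variables `y`. -/
abbrev LaurentPoly (K : Type*) [Field K] (N M : ℕ) : Type _ := MvPolynomial (Fin M) (Laurent K N)

/-- The term `a x^α y^β` of `K[x^*, y]`. -/
def term (α : Fin N → ℤ) (β : Fin M →₀ ℕ) (a : K) : LaurentPoly K N M :=
  MvPolynomial.monomial β (AddMonoidAlgebra.single α a)

/-- The natural inclusion `K[x, y] ⊆ K[x^*, y]`. -/
def polyToLaurent (K : Type*) [Field K] (N M : ℕ) :
    MvPolynomial (Fin N ⊕ Fin M) K →ₐ[K] LaurentPoly K N M :=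
  MvPolynomial.aeval (Sum.elim (fun i => term (Pi.single i 1) 0 1) MvPolynomial.X)

/-- The image of the zero set `V(J) ⊆ K^(N+M)` under the projection to `K^N`. -/
def projZeros (J : Ideal (MvPolynomial (Fin N ⊕ Fin M) K)) : Set (Fin N → K) :=
  (fun z i => z (Sum.inl i)) '' MvPolynomial.zeroLocus K J

/-- The fibre over `a ∈ K^N` of the projection `V(J) → K^N`. -/
def fiber (J : Ideal (MvPolynomial (Fin N ⊕ Fin M) K)) (a : Fin N → K) :
    Set (Fin N ⊕ Fin M → K) :=
  {z ∈ MvPolynomial.zeroLocus K J | (fun i => z (Sum.inl i)) = a}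

/-- `J ⊆ K[x, y]` is `N`-admissible when the projection `V(J) → K^N` is dominant (its image is
Zariski dense) and has finite generic fibre (the fibres over some nonempty Zariski open set
`{g ≠ 0}` are finite). -/
def IsAdmissiblePoly (J : Ideal (MvPolynomial (Fin N ⊕ Fin M) K)) : Prop :=
  MvPolynomial.zeroLocus K (MvPolynomial.vanishingIdeal K (projZeros J)) = Set.univ ∧
    ∃ g : MvPolynomial (Fin N) K, g ≠ 0 ∧
      ∀ a : Fin N → K, MvPolynomial.eval a g ≠ 0 → (fiber J a).Finite

/-- `I ⊆ K[x^*, y]` is `N`-admissible when `I ∩ K[x, y]` is. -/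
def IsAdmissible (I : Ideal (LaurentPoly K N M)) : Prop :=
  IsAdmissiblePoly (I.comap (polyToLaurent K N M))

/-- `x^α` with integral exponents, as a multiplicative map to `S_ω`. -/
def xPow (K : Type*) [Field K] (ω : Fin N → ℝ) : Multiplicative (Fin N → ℤ) →* SOmega K ω where
  toFun α := mono ω (fun i => (α.toAdd i : ℚ)) 1
  map_one' := by
    apply Subtype.ext
    change HahnSeries.single (Expo.of ω fun i => ((0 : ℤ) : ℚ)) (1 : K) = 1
    simp only [Int.cast_zero]
    rfl
  map_mul' α β := by
    apply Subtype.ext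
    change HahnSeries.single (Expo.of ω _) (1 : K) =
      HahnSeries.single (Expo.of ω _) (1 : K) * HahnSeries.single (Expo.of ω _) (1 : K)
    rw [HahnSeries.single_mul_single, one_mul, ← map_add]
    congr 2
    funext i
    exact Int.cast_add _ _

/-- The natural inclusion `K[x^*] ⊆ S_ω`. -/
def laurentToSeries (K : Type*) [Field K] (ω : Fin N → ℝ) : Laurent K N →ₐ[K] SOmega K ω :=
  AddMonoidAlgebra.lift K (SOmega K ω) (Fin N → ℤ) (xPow K ω)

/-- The extension `I^e` of `I ⊆ K[x^*, y]` to `S_ω[y]`. -/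
def extended (ω : Fin N → ℝ) (I : Ideal (LaurentPoly K N M)) :
    Ideal (MvPolynomial (Fin M) (SOmega K ω)) :=
  I.map (MvPolynomial.map (laurentToSeries K ω).toRingHom)

/-- `φ ∈ S_ω^M` is an `ω`-solution of `I` when it is a common zero of the extended ideal. -/
def IsSolution {ω : Fin N → ℝ} (I : Ideal (LaurentPoly K N M)) (φ : Fin M → SOmega K ω) : Prop :=
  ∀ f ∈ extended ω I, MvPolynomial.eval φ f = 0

/-! ## Initial ideals and the tropical variety -/

/-- The weight `ω · α + η · β` of `x^α y^β`, where `∞ · 0 = 0` and `∞ · n = ∞` for `n > 0`. -/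
def weight (ω : Fin N → ℝ) (η : Fin M → WithTop ℝ) (α : Fin N → ℤ) (β : Fin M →₀ ℕ) : WithTop ℝ :=
  ((∑ i, ω i * (α i : ℝ) : ℝ) : WithTop ℝ) + ∑ j, β j • η j

/-- The `(ω, η)`-order: the minimal weight of the terms of `f`. -/
def ordPol (ω : Fin N → ℝ) (η : Fin M → WithTop ℝ) (f : LaurentPoly K N M) : WithTop ℝ :=
  f.support.inf fun β => (MvPolynomial.coeff β f).coeff.support.inf fun α => weight ω η α β

open scoped Classical in
/-- The `(ω, η)`-initial part: the sum of the terms of minimal weight if this weight is finite,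
and `0` otherwise. -/
def inPol (ω : Fin N → ℝ) (η : Fin M → WithTop ℝ) (f : LaurentPoly K N M) : LaurentPoly K N M :=
  if ordPol ω η f = ⊤ then 0
  else ∑ β ∈ f.support, ∑ α ∈ (MvPolynomial.coeff β f).coeff.support with weight ω η α β = ordPol ω η f,
    term α β ((MvPolynomial.coeff β f).coeff α)

/-- The `(ω, η)`-initial ideal of `I`. -/
def initialIdeal (ω : Fin N → ℝ) (η : Fin M → WithTop ℝ) (I : Ideal (LaurentPoly K N M)) :
    Ideal (LaurentPoly K N M) :=
  Ideal.span (inPol ω η '' (I : Set (LaurentPoly K N M)) ∪ MvPolynomial.X '' {j | η j = ⊤})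

/-- The tropical variety of `I`: the weights `(ω, η)`, `ω ∈ ℝ^N`, `η ∈ (ℝ ∪ {∞})^M`, for which the
`(ω, η)`-initial ideal contains no monomial `a x^α y^β`, `a ≠ 0`, in the variables `x` and those
`y_j` with `η_j ≠ ∞`. -/
def tropicalVariety (I : Ideal (LaurentPoly K N M)) :
    Set ((Fin N → ℝ) × (Fin M → WithTop ℝ)) :=
  {p | ∀ (α : Fin N → ℤ) (β : Fin M →₀ ℕ) (a : K), a ≠ 0 →
    term α β a ∈ MvPolynomial.supported (Laurent K N) {j | p.2 j ≠ ⊤} →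
    term α β a ∉ initialIdeal p.1 p.2 I}

end OmegaPuiseux

end

/-!
The tropical condition is implied by the other one: a monomial in the variables `x_i` and the `y_j`
with `φ_j ≠ 0` does not vanish at `φ`, so it cannot lie in an ideal that `φ` solves
(`mem_tropicalVariety`). The theorem therefore says that `φ` is the first term of a solution of `I`
exactly when it solves the initial ideal. One direction is a computation with lowest terms
(`isSolution_initialIdeal`): for a solution `ψ` with first term `φ`, the part of weight
`ord f` of `f(ψ) = 0` is `(In f)(φ)`.

For the converse, call `F ∈ S_ω[y]` *regular at `φ`* if the weight of `F(φ)` is not larger than the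
weights of all the terms of `F`, when `y_j` is given the weight `ord φ_j`. Because the weights
`ω · α` separate exponents, this property is multiplicative (`regularAt`), and `y_j - p` has it
whenever the first term of `p` is not `φ_j` (`X_sub_C_mem_regularAt`). If `φ` solves the initial
ideal, no element of the extension `I^e` to `S_ω[y]` is regular at `φ` (`notMem_regularAt`). The
difficulty here is that the coefficients of elements of `I^e` have fractional exponents and
infinitely many terms; splitting a series along the cosets of `ℤ^N` in `ℚ^N`, and truncating it,
reduces to elements of `I`. By admissibility `I` has only finitely many `ω`-solutions
(`finite_setOf_isSolution`): for each `j` some nonzero polynomial in `x` and `y_j` alone lies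
in `I`. If none of these solutions had first term `φ`, a product of factors `y_j - p_j`, all regular
at `φ`, would vanish on all of them, and by the Nullstellensatz a power of it would lie in `I^e`, a
contradiction (`exists_isSolution_inser_eq`).

The Nullstellensatz needs `S_ω` to be an algebraically closed field. Finitely many series whose
weights are nonnegative are images of power series in finitely many variables under one substitution
of monomials of positive weight (`exists_substHom_of_finset`), because the exponents lie in a
finitely generated monoid. So inverses exist, and roots of polynomials are found by the
Newton-Puiseux method: a translation and a rescaling reduce to a monic polynomial over the power
series ring whose reduction has a root of multiplicity smaller than the degree, and the Weierstrass
preparation theorem over that complete local ring splits off a factor of smaller degree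
(`exists_monic_dvd_of_isUnit_coeff`, `exists_root_of_monic`).
-/

noncomputable section

namespace OmegaPuiseux

variable {K : Type*} [Field K] {N M : ℕ}

/-! ### The weight filtration of the series ring -/

section Filtration

variable {ω : Fin N → ℝ}

theorem Expo.wt_zero : (0 : Expo ω).wt = 0 := by
  have := Expo.wt_add (0 : Expo ω) 0
  rw [add_zero] at this
  linarith

theorem Expo.wt_neg (α : Expo ω) : (-α).wt = -α.wt := by
  have := Expo.wt_add α (-α)
  rw [add_neg_cancel, Expo.wt_zero] at this
  linarith

/-- The series all of whose exponents have a weight in `S`. -/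
def weightSub (K : Type*) [Field K] (ω : Fin N → ℝ) (S : Set (WithTop ℝ)) :
    AddSubgroup (SOmega K ω) where
  carrier := {s | ∀ α : Expo ω, s.1.coeff α ≠ 0 → (α.wt : WithTop ℝ) ∈ S}
  zero_mem' α h := absurd rfl h
  add_mem' {s t} hs ht α h := by
    by_cases h1 : s.1.coeff α = 0
    · by_cases h2 : t.1.coeff α = 0
      · exact absurd (by simp [h1, h2]) h
      · exact ht α h2
    · exact hs α h1
  neg_mem' {s} hs α h := hs α fun h' => h (by simp [h'])

/-- The series all of whose exponents have weight at least `m`; only `0` if `m = ∞`. -/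
abbrev geSub (K : Type*) [Field K] (ω : Fin N → ℝ) (m : WithTop ℝ) : AddSubgroup (SOmega K ω) :=
  weightSub K ω (Set.Ici m)

/-- The series all of whose exponents have weight greater than `m`; only `0` if `m = ∞`. -/
abbrev gtSub (K : Type*) [Field K] (ω : Fin N → ℝ) (m : WithTop ℝ) : AddSubgroup (SOmega K ω) :=
  weightSub K ω (Set.Ioi m)

/-- The series all of whose exponents have weight at most `m`. -/
abbrev leSub (K : Type*) [Field K] (ω : Fin N → ℝ) (m : WithTop ℝ) : AddSubgroup (SOmega K ω) :=
  weightSub K ω (Set.Iic m)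

theorem gtSub_le_geSub (m : WithTop ℝ) : gtSub K ω m ≤ geSub K ω m := fun _ h α hα =>
  Set.mem_Ici.2 (Set.mem_Ioi.1 (h α hα)).le

theorem gtSub_anti {m n : WithTop ℝ} (h : m ≤ n) : gtSub K ω n ≤ gtSub K ω m :=
  fun _ hs α hα => h.trans_lt (hs α hα)

@[ext]
theorem SOmega.ext_coeff {s t : SOmega K ω} (h : ∀ α, s.1.coeff α = t.1.coeff α) : s = t :=
  Subtype.ext (HahnSeries.ext (funext h))

theorem nontrivial_SOmega : Nontrivial (SOmega K ω) :=
  ⟨⟨0, 1, fun h => by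
    have := congrArg (fun s : SOmega K ω => s.1.coeff 0) h
    simp at this⟩⟩

theorem eq_zero_of_mem_geSub_top {s : SOmega K ω} (h : s ∈ geSub K ω ⊤) : s = 0 := by
  ext α
  by_contra h0
  exact absurd (h α h0) (by simp)

theorem exists_of_coeff_mul_ne_zero {s t : SOmega K ω} {γ : Expo ω} (h : (s * t).1.coeff γ ≠ 0) :
    ∃ α β, s.1.coeff α ≠ 0 ∧ t.1.coeff β ≠ 0 ∧ α + β = γ := by
  obtain ⟨α, hα, β, hβ, h⟩ := HahnSeries.support_mul_subset
    ((HahnSeries.mem_support (s.1 * t.1) γ).2 h)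
  exact ⟨α, β, hα, hβ, h⟩

theorem mul_mem_weightSub {S T U : Set (WithTop ℝ)} {s t : SOmega K ω} (hs : s ∈ weightSub K ω S)
    (ht : t ∈ weightSub K ω T)
    (h : ∀ x y : ℝ, (x : WithTop ℝ) ∈ S → (y : WithTop ℝ) ∈ T → (x + y : WithTop ℝ) ∈ U) :
    s * t ∈ weightSub K ω U := by
  intro γ hγ
  obtain ⟨α, β, hα, hβ, rfl⟩ := exists_of_coeff_mul_ne_zero hγ
  rw [Expo.wt_add, WithTop.coe_add]
  exact h _ _ (hs α hα) (ht β hβ)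

theorem mul_mem_geSub {m n : WithTop ℝ} {s t : SOmega K ω} (hs : s ∈ geSub K ω m)
    (ht : t ∈ geSub K ω n) : s * t ∈ geSub K ω (m + n) :=
  mul_mem_weightSub hs ht fun _ _ h1 h2 => Set.mem_Ici.2 (add_le_add h1 h2)

theorem add_lt_add_coe {a b : WithTop ℝ} {x y : ℝ} (h1 : a < x) (h2 : b ≤ y) :
    a + b < (x : WithTop ℝ) + y := by
  lift a to ℝ using (h1.trans_le le_top).ne
  lift b to ℝ using (h2.trans_lt (WithTop.coe_lt_top y)).ne
  norm_cast at *
  linarith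

theorem mul_mem_gtSub {m n : WithTop ℝ} {s t : SOmega K ω} (hs : s ∈ gtSub K ω m)
    (ht : t ∈ geSub K ω n) : s * t ∈ gtSub K ω (m + n) :=
  mul_mem_weightSub hs ht fun _ _ h1 h2 => add_lt_add_coe h1 h2

theorem mul_mem_gtSub' {m n : WithTop ℝ} {s t : SOmega K ω} (hs : s ∈ geSub K ω m)
    (ht : t ∈ gtSub K ω n) : s * t ∈ gtSub K ω (m + n) := by
  rw [mul_comm, add_comm]
  exact mul_mem_gtSub ht hs

theorem coeff_add_mul (hω : LinearIndependent ℚ ω) {s t : SOmega K ω} {α β : Expo ω}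
    (hs : s ∈ geSub K ω α.wt) (ht : t ∈ geSub K ω β.wt) :
    (s * t).1.coeff (α + β) = s.1.coeff α * t.1.coeff β := by
  change (s.1 * t.1).coeff (α + β) = _
  rw [HahnSeries.coeff_mul]
  refine Finset.sum_eq_single (α, β) ?_ ?_
  · rintro ⟨γ, δ⟩ h hne
    obtain ⟨h1, h2, h3⟩ := Finset.mem_antidiagonal.1 h
    have h4 := WithTop.coe_le_coe.1 (hs γ h1)
    have h5 := WithTop.coe_le_coe.1 (ht δ h2)
    have h6 : γ.wt + δ.wt = α.wt + β.wt := by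
      rw [← Expo.wt_add, ← Expo.wt_add]; exact congrArg _ h3
    exact absurd (Prod.ext (Expo.wt_injective hω (show γ.wt = α.wt by linarith))
      (Expo.wt_injective hω (show δ.wt = β.wt by linarith))) hne
  · intro h
    by_contra h0
    exact h (Finset.mem_antidiagonal.2
      ⟨left_ne_zero_of_mul h0, right_ne_zero_of_mul h0, rfl⟩)

/-! ### First terms -/

theorem coeff_mono (a : Fin N → ℚ) (c : K) (β : Expo ω) [Decidable (β = Expo.of ω a)] :
    (mono ω a c).1.coeff β = if β = Expo.of ω a then c else 0 := by
  classical
  simp only [mono, HahnSeries.coeff_single]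
  split_ifs <;> simp_all

theorem mono_zero (a : Fin N → ℚ) : mono ω a (0 : K) = 0 := by
  classical
  ext β
  rw [coeff_mono]
  simp

theorem mono_mul_mono (a b : Fin N → ℚ) (c d : K) :
    mono ω a c * mono ω b d = mono ω (a + b) (c * d) :=
  Subtype.ext (HahnSeries.single_mul_single ..)

theorem mono_zero_one : mono ω (0 : Fin N → ℚ) (1 : K) = 1 := rfl

theorem coeff_mono_mul (a : Fin N → ℚ) (c : K) (s : SOmega K ω) (β : Expo ω) :
    (mono ω a c * s).1.coeff (β + Expo.of ω a) = c * s.1.coeff β :=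
  HahnSeries.coeff_single_mul_add

theorem coeff_mono_mul' (a : Fin N → ℚ) (c : K) (s : SOmega K ω) (β : Expo ω) :
    (mono ω a c * s).1.coeff β = c * s.1.coeff (β - Expo.of ω a) := by
  rw [← coeff_mono_mul, sub_add_cancel]

theorem mono_mem_weightSub {S : Set (WithTop ℝ)} {a : Fin N → ℚ}
    (h : ((Expo.of ω a).wt : WithTop ℝ) ∈ S) (c : K) : mono ω a c ∈ weightSub K ω S := by
  classical
  intro β hβ
  rw [coeff_mono] at hβ
  split_ifs at hβ with h'
  · rwa [h']
  · exact absurd rfl hβ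

/-- A nonzero series has a term of least weight, and this is its first term. -/
theorem exists_leading {s : SOmega K ω} (hs : s ≠ 0) :
    ∃ α : Expo ω, s.1.coeff α ≠ 0 ∧ s ∈ geSub K ω α.wt ∧
      inser s = mono ω ((Expo.of ω).symm α) (s.1.coeff α) := by
  have hs' : s.1 ≠ 0 := fun h => hs (Subtype.ext h)
  have h0 := HahnSeries.orderTop_of_ne_zero hs'
  set α := s.1.isWF_support.min (HahnSeries.support_nonempty_iff.2 hs')
  have hmem : s.1.coeff α ≠ 0 := s.1.isWF_support.min_mem _
  refine ⟨α, hmem, fun β hβ => ?_, ?_⟩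
  · rw [Set.mem_Ici, WithTop.coe_le_coe]
    by_contra! h
    exact s.1.isWF_support.not_lt_min (HahnSeries.support_nonempty_iff.2 hs')
      ((HahnSeries.mem_support _ _).2 hβ)
      (lt_of_le_of_ne (Or.inr h) fun h' => h.ne (by rw [h']))
  · rw [inser, h0]
    rfl

theorem eq_of_leading (hω : LinearIndependent ℚ ω) {s : SOmega K ω} {α β : Expo ω}
    (h1 : s.1.coeff α ≠ 0) (h2 : s ∈ geSub K ω α.wt) (h3 : s.1.coeff β ≠ 0)
    (h4 : s ∈ geSub K ω β.wt) : α = β :=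
  Expo.wt_injective hω (le_antisymm (WithTop.coe_le_coe.1 (h2 β h3))
    (WithTop.coe_le_coe.1 (h4 α h1)))

theorem inser_zero : inser (0 : SOmega K ω) = 0 := by
  simp [inser]

theorem ordser_mono (a : Fin N → ℚ) {c : K} (hc : c ≠ 0) :
    ordser (mono ω a c) = ((Expo.of ω a).wt : WithTop ℝ) := by
  rw [ordser, mono, HahnSeries.orderTop_single hc]
  rfl

theorem ordser_zero : ordser (0 : SOmega K ω) = ⊤ := by
  simp [ordser]

theorem mono_mem_weightSub_ordser {S : Set (WithTop ℝ)} {a : Fin N → ℚ} {c : K}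
    (h : ordser (mono ω a c) ∈ S) : mono ω a c ∈ weightSub K ω S := by
  rcases eq_or_ne c 0 with rfl | hc
  · rw [mono_zero]; exact zero_mem _
  · rw [ordser_mono a hc] at h
    exact mono_mem_weightSub h c

/-- A series differs from its first term by terms of greater weight. -/
theorem sub_mem_gtSub_of_inser_eq (hω : LinearIndependent ℚ ω) {s : SOmega K ω} {a : Fin N → ℚ}
    {c : K} (h : inser s = mono ω a c) : s - mono ω a c ∈ gtSub K ω (ordser (mono ω a c)) := by
  classical
  rcases eq_or_ne s 0 with rfl | hs
  · rw [← h, inser_zero, sub_zero]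
    exact zero_mem _
  obtain ⟨α, h1, h2, h3⟩ := exists_leading hs
  rw [← h, h3, ordser_mono _ h1]
  intro β hβ
  have hne : β ≠ α := by
    rintro rfl
    apply hβ
    simp [coeff_mono]
  have hβ' : s.1.coeff β ≠ 0 := by
    intro h0
    apply hβ
    simp [coeff_mono, h0, hne]
  exact lt_of_le_of_ne (h2 β hβ') fun h =>
    hne (Expo.wt_injective hω (WithTop.coe_injective h)).symm

/-- If the first term of `s` is not the monomial `φ`, then no cancellation occurs in `φ - s`. -/
theorem exists_coeff_sub_ne_zero (hω : LinearIndependent ℚ ω) {s : SOmega K ω} {a : Fin N → ℚ}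
    {c : K} (h : inser s ≠ mono ω a c) : ∃ α : Expo ω, (α.wt : WithTop ℝ) ≤ ordser (mono ω a c) ∧
      s ∈ geSub K ω α.wt ∧ (mono ω a c - s).1.coeff α ≠ 0 := by
  classical
  rcases eq_or_ne c 0 with rfl | hc
  · have hs : s ≠ 0 := by
      rintro rfl
      rw [inser_zero, mono_zero] at h
      exact h rfl
    obtain ⟨α, h1, h2, -⟩ := exists_leading hs
    refine ⟨α, ?_, h2, ?_⟩
    · rw [mono_zero, ordser_zero]
      exact le_top
    · rw [mono_zero, zero_sub]
      simpa using h1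
  by_cases hge : s ∈ geSub K ω (Expo.of ω a).wt
  · refine ⟨Expo.of ω a, (ordser_mono a hc).ge, hge, fun h0 => h ?_⟩
    have h1 : s.1.coeff (Expo.of ω a) = c := by
      have : (mono ω a c).1.coeff (Expo.of ω a) - s.1.coeff (Expo.of ω a) = 0 := h0
      rw [coeff_mono, if_pos rfl, sub_eq_zero] at this
      exact this.symm
    have hs : s ≠ 0 := by
      rintro rfl
      exact hc h1.symm
    obtain ⟨α, h2, h3, h4⟩ := exists_leading hs
    have := eq_of_leading hω h2 h3 (h1.trans_ne hc) hge
    rw [h4, this, h1, AddEquiv.symm_apply_apply]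
  · have hs : s ≠ 0 := by
      rintro rfl
      exact hge (zero_mem _)
    obtain ⟨α, h2, h3, h4⟩ := exists_leading hs
    have hlt : α.wt < (Expo.of ω a).wt := by
      by_contra! hle
      exact hge fun β hβ => (WithTop.coe_le_coe.2 hle).trans (h3 β hβ)
    refine ⟨α, ?_, h3, ?_⟩
    · rw [ordser_mono a hc]
      exact_mod_cast hlt.le
    · have hne : α ≠ Expo.of ω a := by
        rintro rfl
        exact hlt.ne rfl
      change (mono ω a c).1.coeff α - s.1.coeff α ≠ 0
      rw [coeff_mono, if_neg hne, zero_sub]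
      exact neg_ne_zero.2 h2

end Filtration

/-! ### Polynomials over the series ring, weighted by `η` -/

section PolyWeight

variable {ω : Fin N → ℝ}

theorem coeff_sum {ι : Type*} (s : Finset ι) (f : ι → SOmega K ω) (α : Expo ω) :
    (∑ i ∈ s, f i).1.coeff α = ∑ i ∈ s, (f i).1.coeff α := by
  classical
  induction s using Finset.induction_on with
  | empty => simp
  | insert i s hi ih => rw [Finset.sum_insert hi, Finset.sum_insert hi, ← ih]; rfl

theorem exists_of_coeff_sum_ne_zero {ι : Type*} {s : Finset ι} {f : ι → SOmega K ω} {α : Expo ω}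
    (h : (∑ i ∈ s, f i).1.coeff α ≠ 0) : ∃ i ∈ s, (f i).1.coeff α ≠ 0 := by
  rw [coeff_sum] at h
  exact Finset.exists_ne_zero_of_sum_ne_zero h

/-- The weight `η · β` of the monomial `y^β`. -/
def yWeight (η : Fin M → WithTop ℝ) (β : Fin M →₀ ℕ) : WithTop ℝ := ∑ j, β j • η j

theorem yWeight_add (η : Fin M → WithTop ℝ) (β γ : Fin M →₀ ℕ) :
    yWeight η (β + γ) = yWeight η β + yWeight η γ := by
  simp [yWeight, add_smul, Finset.sum_add_distrib]

theorem yWeight_zero (η : Fin M → WithTop ℝ) : yWeight η 0 = 0 := by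
  simp [yWeight]

theorem yWeight_single (η : Fin M → WithTop ℝ) (j : Fin M) :
    yWeight η (Finsupp.single j 1) = η j := by
  classical
  rw [yWeight, Finset.sum_eq_single j]
  · simp
  · intro i _ hi
    simp [Finsupp.single_eq_of_ne hi]
  · simp

/-- The polynomials over `S_ω` all of whose terms have a weight in `S`. -/
def polySub (K : Type*) [Field K] (ω : Fin N → ℝ) (η : Fin M → WithTop ℝ) (S : Set (WithTop ℝ)) :
    AddSubgroup (MvPolynomial (Fin M) (SOmega K ω)) where
  carrier := {F | ∀ (β : Fin M →₀ ℕ) (α : Expo ω), (F.coeff β).1.coeff α ≠ 0 →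
    (α.wt : WithTop ℝ) + yWeight η β ∈ S}
  zero_mem' β α h := absurd rfl h
  add_mem' {F G} hF hG β α h := by
    rw [MvPolynomial.coeff_add] at h
    by_cases h1 : (F.coeff β).1.coeff α = 0
    · by_cases h2 : (G.coeff β).1.coeff α = 0
      · exact absurd (by simp [h1, h2]) h
      · exact hG β α h2
    · exact hF β α h1
  neg_mem' {F} hF β α h := hF β α fun h' => h (by simp [MvPolynomial.coeff_neg, h'])

theorem mul_mem_polySub {η : Fin M → WithTop ℝ} {S T U : Set (WithTop ℝ)}
    {F G : MvPolynomial (Fin M) (SOmega K ω)} (hF : F ∈ polySub K ω η S)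
    (hG : G ∈ polySub K ω η T) (h : ∀ x ∈ S, ∀ y ∈ T, x + y ∈ U) : F * G ∈ polySub K ω η U := by
  classical
  intro β α hα
  rw [MvPolynomial.coeff_mul] at hα
  obtain ⟨⟨β₁, β₂⟩, hβ, hne⟩ := exists_of_coeff_sum_ne_zero hα
  obtain ⟨α₁, α₂, h1, h2, rfl⟩ := exists_of_coeff_mul_ne_zero hne
  rw [← Finset.HasAntidiagonal.mem_antidiagonal.1 hβ, yWeight_add, Expo.wt_add, WithTop.coe_add,
    add_add_add_comm]
  exact h _ (hF _ _ h1) _ (hG _ _ h2)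

theorem C_mem_polySub {η : Fin M → WithTop ℝ} {S : Set (WithTop ℝ)} {s : SOmega K ω}
    (hs : s ∈ weightSub K ω S) : MvPolynomial.C s ∈ polySub K ω η S := by
  classical
  intro β α hα
  rw [MvPolynomial.coeff_C] at hα
  split_ifs at hα with h
  · rw [← h, yWeight_zero, add_zero]
    exact hs α hα
  · exact absurd rfl hα

theorem X_mem_polySub {η : Fin M → WithTop ℝ} {S : Set (WithTop ℝ)} {j : Fin M} (h : η j ∈ S) :
    (MvPolynomial.X j : MvPolynomial (Fin M) (SOmega K ω)) ∈ polySub K ω η S := by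
  classical
  intro β α hα
  rw [MvPolynomial.coeff_X] at hα
  split_ifs at hα with h1
  · have : α = 0 := by
      by_contra h0
      exact hα (by simp [h0])
    rw [← h1, yWeight_single, this, Expo.wt_zero, WithTop.coe_zero, zero_add]
    exact h
  · exact absurd rfl hα

theorem one_mem_weightSub {S : Set (WithTop ℝ)} (h : 0 ∈ S) : (1 : SOmega K ω) ∈ weightSub K ω S := by
  rw [← mono_zero_one]
  refine mono_mem_weightSub ?_ _
  rw [map_zero, Expo.wt_zero]
  exact h

theorem prod_pow_mem_weightSub {P : WithTop ℝ → Set (WithTop ℝ)} (h0 : 0 ∈ P 0)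
    (hadd : ∀ m n : WithTop ℝ, ∀ x ∈ P m, ∀ y ∈ P n, x + y ∈ P (m + n))
    {η : Fin M → WithTop ℝ} {φ : Fin M → SOmega K ω} (hφ : ∀ j, φ j ∈ weightSub K ω (P (η j)))
    (β : Fin M →₀ ℕ) : ∏ j, φ j ^ β j ∈ weightSub K ω (P (yWeight η β)) := by
  classical
  have hpow : ∀ j (n : ℕ), φ j ^ n ∈ weightSub K ω (P (n • η j)) := by
    intro j n
    induction n with
    | zero => simpa using one_mem_weightSub h0
    | succ n ih =>
      rw [pow_succ, succ_nsmul]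
      exact mul_mem_weightSub ih (hφ j) fun x y hx hy => hadd _ _ x hx y hy
  rw [yWeight]
  induction (Finset.univ : Finset (Fin M)) using Finset.induction_on with
  | empty => simpa using one_mem_weightSub h0
  | insert i s hi ih =>
    rw [Finset.prod_insert hi, Finset.sum_insert hi]
    exact mul_mem_weightSub (hpow _ _) ih fun x y hx hy => hadd _ _ x hx y hy

theorem prod_pow_mem_geSub {η : Fin M → WithTop ℝ} {φ : Fin M → SOmega K ω}
    (hφ : ∀ j, φ j ∈ geSub K ω (η j)) (β : Fin M →₀ ℕ) :
    ∏ j, φ j ^ β j ∈ geSub K ω (yWeight η β) :=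
  prod_pow_mem_weightSub (P := Set.Ici) Set.self_mem_Ici
    (fun _ _ _ hx _ hy => Set.mem_Ici.2 (add_le_add hx hy)) hφ β

theorem prod_pow_mem_leSub {η : Fin M → WithTop ℝ} {φ : Fin M → SOmega K ω}
    (hφ : ∀ j, φ j ∈ leSub K ω (η j)) (β : Fin M →₀ ℕ) :
    ∏ j, φ j ^ β j ∈ leSub K ω (yWeight η β) :=
  prod_pow_mem_weightSub (P := Set.Iic) Set.self_mem_Iic
    (fun _ _ _ hx _ hy => Set.mem_Iic.2 (add_le_add hx hy)) hφ β

theorem mul_sub_mul_mem_gtSub {m n : WithTop ℝ} {a b c d : SOmega K ω}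
    (hb : b ∈ geSub K ω m) (hab : a - b ∈ gtSub K ω m) (hc : c ∈ geSub K ω n)
    (hcd : c - d ∈ gtSub K ω n) : a * c - b * d ∈ gtSub K ω (m + n) := by
  have : a * c - b * d = (a - b) * c + b * (c - d) := by ring
  rw [this]
  exact add_mem (mul_mem_gtSub hab hc) (mul_mem_gtSub' hb hcd)

theorem mem_geSub_of_sub_mem {m : WithTop ℝ} {a b : SOmega K ω} (hb : b ∈ geSub K ω m)
    (h : a - b ∈ gtSub K ω m) : a ∈ geSub K ω m := by
  rw [← sub_add_cancel a b]
  exact add_mem (gtSub_le_geSub _ h) hb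

theorem prod_pow_sub_mem_gtSub {η : Fin M → WithTop ℝ} {φ ψ : Fin M → SOmega K ω}
    (hφ : ∀ j, φ j ∈ geSub K ω (η j)) (h : ∀ j, ψ j - φ j ∈ gtSub K ω (η j)) (β : Fin M →₀ ℕ) :
    ∏ j, ψ j ^ β j - ∏ j, φ j ^ β j ∈ gtSub K ω (yWeight η β) := by
  classical
  have key : ∀ j (n : ℕ), φ j ^ n ∈ geSub K ω (n • η j) ∧
      ψ j ^ n - φ j ^ n ∈ gtSub K ω (n • η j) := by
    intro j n
    induction n with
    | zero => exact ⟨by simpa using one_mem_weightSub Set.self_mem_Ici, by simp⟩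
    | succ n ih =>
      rw [pow_succ, pow_succ, succ_nsmul]
      exact ⟨mul_mem_geSub ih.1 (hφ j),
        mul_sub_mul_mem_gtSub ih.1 ih.2 (mem_geSub_of_sub_mem (hφ j) (h j)) (h j)⟩
  rw [yWeight]
  suffices H : ∀ s : Finset (Fin M), ∏ j ∈ s, φ j ^ β j ∈ geSub K ω (∑ j ∈ s, β j • η j) ∧
      ∏ j ∈ s, ψ j ^ β j - ∏ j ∈ s, φ j ^ β j ∈ gtSub K ω (∑ j ∈ s, β j • η j) from
    (H Finset.univ).2
  intro s
  induction s using Finset.induction_on with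
  | empty => exact ⟨by simpa using one_mem_weightSub Set.self_mem_Ici, by simp⟩
  | insert i s hi ih =>
    rw [Finset.prod_insert hi, Finset.prod_insert hi, Finset.sum_insert hi]
    exact ⟨mul_mem_geSub (key _ _).1 ih.1, mul_sub_mul_mem_gtSub (key _ _).1 (key _ _).2
      (mem_geSub_of_sub_mem ih.1 ih.2) ih.2⟩

/-- A sum `∑ F_β u_β` has weights in `S` if all `(weight of a term of F_β) + (weight of u_β)`
are in `S`. -/
theorem sum_coeff_mul_mem_weightSub {S : Set (WithTop ℝ)} {T : (Fin M →₀ ℕ) → Set (WithTop ℝ)}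
    {F : MvPolynomial (Fin M) (SOmega K ω)} {u : (Fin M →₀ ℕ) → SOmega K ω}
    (hu : ∀ β, u β ∈ weightSub K ω (T β))
    (h : ∀ β (α : Expo ω), (F.coeff β).1.coeff α ≠ 0 → ∀ y : ℝ, (y : WithTop ℝ) ∈ T β →
      (α.wt : WithTop ℝ) + y ∈ S) :
    ∑ β ∈ F.support, F.coeff β * u β ∈ weightSub K ω S := by
  refine sum_mem fun β _ γ hγ => ?_
  obtain ⟨α, δ, h1, h2, rfl⟩ := exists_of_coeff_mul_ne_zero hγ
  rw [Expo.wt_add, WithTop.coe_add]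
  exact h β α h1 _ (hu β δ h2)

theorem eval_mem_geSub {η : Fin M → WithTop ℝ} {φ : Fin M → SOmega K ω}
    (hφ : ∀ j, φ j ∈ geSub K ω (η j)) {m : WithTop ℝ} {F : MvPolynomial (Fin M) (SOmega K ω)}
    (hF : F ∈ polySub K ω η (Set.Ici m)) : MvPolynomial.eval φ F ∈ geSub K ω m := by
  rw [MvPolynomial.eval_eq']
  exact sum_coeff_mul_mem_weightSub (prod_pow_mem_geSub hφ) fun β α h y hy =>
    Set.mem_Ici.2 (le_trans (Set.mem_Ici.1 (hF β α h)) (add_le_add le_rfl hy))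

theorem eval_mem_gtSub {η : Fin M → WithTop ℝ} {φ : Fin M → SOmega K ω}
    (hφ : ∀ j, φ j ∈ geSub K ω (η j)) {m : WithTop ℝ} {F : MvPolynomial (Fin M) (SOmega K ω)}
    (hF : F ∈ polySub K ω η (Set.Ioi m)) : MvPolynomial.eval φ F ∈ gtSub K ω m := by
  rw [MvPolynomial.eval_eq']
  exact sum_coeff_mul_mem_weightSub (prod_pow_mem_geSub hφ) fun β α h y hy =>
    Set.mem_Ioi.2 (lt_of_lt_of_le (Set.mem_Ioi.1 (hF β α h)) (add_le_add le_rfl hy))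

theorem eval_mem_leSub {η : Fin M → WithTop ℝ} {φ : Fin M → SOmega K ω}
    (hφ : ∀ j, φ j ∈ leSub K ω (η j)) {m : WithTop ℝ} {F : MvPolynomial (Fin M) (SOmega K ω)}
    (hF : F ∈ polySub K ω η (Set.Iic m)) : MvPolynomial.eval φ F ∈ leSub K ω m := by
  rw [MvPolynomial.eval_eq']
  exact sum_coeff_mul_mem_weightSub (prod_pow_mem_leSub hφ) fun β α h y hy =>
    Set.mem_Iic.2 (le_trans (add_le_add le_rfl hy) (Set.mem_Iic.1 (hF β α h)))

/-- Replacing a point by another one with the same first terms changes the value of a polynomial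
only by terms of weight greater than the order of the polynomial. -/
theorem eval_sub_eval_mem_gtSub {η : Fin M → WithTop ℝ} {φ ψ : Fin M → SOmega K ω}
    (hφ : ∀ j, φ j ∈ geSub K ω (η j)) (h : ∀ j, ψ j - φ j ∈ gtSub K ω (η j)) {m : WithTop ℝ}
    {F : MvPolynomial (Fin M) (SOmega K ω)} (hF : F ∈ polySub K ω η (Set.Ici m)) :
    MvPolynomial.eval ψ F - MvPolynomial.eval φ F ∈ gtSub K ω m := by
  rw [MvPolynomial.eval_eq', MvPolynomial.eval_eq', ← Finset.sum_sub_distrib]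
  simp only [← mul_sub]
  refine sum_coeff_mul_mem_weightSub (prod_pow_sub_mem_gtSub hφ h) fun β α hα y hy => ?_
  refine Set.mem_Ioi.2 (lt_of_le_of_lt (Set.mem_Ici.1 (hF β α hα)) ?_)
  have := add_lt_add_coe hy (le_refl (α.wt : WithTop ℝ))
  rwa [add_comm, add_comm (y : WithTop ℝ)] at this

/-! ### Polynomials whose order is attained at a point -/

/-- The polynomials `F` whose value at `φ` has the least order that the terms of `F` allow. -/
def regularAt (hω : LinearIndependent ℚ ω) (η : Fin M → WithTop ℝ) (φ : Fin M → SOmega K ω)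
    (hφ : ∀ j, φ j ∈ geSub K ω (η j)) : Submonoid (MvPolynomial (Fin M) (SOmega K ω)) where
  carrier := {F | ∃ α : Expo ω, F ∈ polySub K ω η (Set.Ici α.wt) ∧
    (MvPolynomial.eval φ F).1.coeff α ≠ 0}
  one_mem' := by
    refine ⟨0, ?_, ?_⟩
    · rw [← MvPolynomial.C_1]
      refine C_mem_polySub (one_mem_weightSub ?_)
      rw [Expo.wt_zero]
      exact Set.self_mem_Ici
    · rw [map_one]
      change (1 : HahnSeries (Expo ω) K).coeff 0 ≠ 0
      simp
  mul_mem' := by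
    rintro F G ⟨α, hF, hF'⟩ ⟨β, hG, hG'⟩
    refine ⟨α + β, ?_, ?_⟩
    · rw [Expo.wt_add, WithTop.coe_add]
      exact mul_mem_polySub hF hG fun x hx y hy => Set.mem_Ici.2 (add_le_add hx hy)
    · rw [map_mul, coeff_add_mul hω (eval_mem_geSub hφ hF) (eval_mem_geSub hφ hG)]
      exact mul_ne_zero hF' hG'

theorem X_sub_C_mem_regularAt (hω : LinearIndependent ℚ ω) {c : Fin M → K} {a : Fin M → Fin N → ℚ}
    {j : Fin M} {p : SOmega K ω} (h : inser p ≠ mono ω (a j) (c j)) :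
    MvPolynomial.X j - MvPolynomial.C p ∈
      regularAt hω (fun j => ordser (mono ω (a j) (c j))) (fun j => mono ω (a j) (c j))
        fun _ => mono_mem_weightSub_ordser Set.self_mem_Ici := by
  obtain ⟨α, h1, h2, h3⟩ := exists_coeff_sub_ne_zero hω h
  refine ⟨α, sub_mem (X_mem_polySub h1) (C_mem_polySub h2), ?_⟩
  simpa using h3

end PolyWeight

/-! ### Laurent polynomials as polynomials over the series ring -/

section Embed

variable {ω : Fin N → ℝ}

theorem SOmega.eq_zero_or_eq_zero (hω : LinearIndependent ℚ ω) {s t : SOmega K ω}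
    (h : s * t = 0) : s = 0 ∨ t = 0 := by
  by_contra! hne
  obtain ⟨α, h1, h2, -⟩ := exists_leading hne.1
  obtain ⟨β, h3, h4, -⟩ := exists_leading hne.2
  refine mul_ne_zero h1 h3 ?_
  rw [← coeff_add_mul hω h2 h4, h]
  rfl

/-- An integral exponent, as a rational one. -/
def toQ (n : Fin N → ℤ) : Fin N → ℚ := fun i => n i

theorem toQ_injective : Function.Injective (toQ (N := N)) := by
  intro m n h
  funext i
  have := congrFun h i
  simpa [toQ] using this

theorem smul_mono (c d : K) (a : Fin N → ℚ) : c • mono ω a d = mono ω a (c * d) := by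
  classical
  ext β
  change c * (mono ω a d).1.coeff β = _
  rw [coeff_mono, coeff_mono, mul_ite, mul_zero]

theorem laurentToSeries_eq_sum (f : Laurent K N) :
    laurentToSeries K ω f = ∑ n ∈ f.coeff.support, mono ω (toQ n) (f.coeff n) := by
  rw [laurentToSeries, AddMonoidAlgebra.lift_apply, Finsupp.sum]
  refine Finset.sum_congr rfl fun n _ => ?_
  change f.coeff n • mono ω (toQ n) 1 = _
  rw [smul_mono, mul_one]

theorem coeff_laurentToSeries (f : Laurent K N) (n : Fin N → ℤ) :
    (laurentToSeries K ω f).1.coeff (Expo.of ω (toQ n)) = f.coeff n := by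
  classical
  rw [laurentToSeries_eq_sum, coeff_sum]
  simp only [coeff_mono, EmbeddingLike.apply_eq_iff_eq, toQ_injective.eq_iff]
  rw [Finset.sum_ite_eq]
  split_ifs with h
  · rfl
  · exact (Finsupp.notMem_support_iff.1 h).symm

theorem exists_of_coeff_laurentToSeries_ne_zero {f : Laurent K N} {α : Expo ω}
    (h : (laurentToSeries K ω f).1.coeff α ≠ 0) :
    ∃ n, α = Expo.of ω (toQ n) ∧ f.coeff n ≠ 0 := by
  classical
  rw [laurentToSeries_eq_sum] at h
  obtain ⟨n, hn, h⟩ := exists_of_coeff_sum_ne_zero h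
  rw [coeff_mono] at h
  split_ifs at h with h'
  · exact ⟨n, h', h⟩
  · exact absurd rfl h

theorem laurentToSeries_single (n : Fin N → ℤ) (c : K) :
    laurentToSeries K ω (AddMonoidAlgebra.single n c) = mono ω (toQ n) c := by
  rw [laurentToSeries, AddMonoidAlgebra.lift_single]
  change c • mono ω (toQ n) 1 = _
  rw [smul_mono, mul_one]

/-- The inclusion `K[x^*, y] ⊆ S_ω[y]`. -/
abbrev embed (M : ℕ) (ω : Fin N → ℝ) : LaurentPoly K N M →+* MvPolynomial (Fin M) (SOmega K ω) :=
  MvPolynomial.map (laurentToSeries K ω).toRingHom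

theorem coeff_embed (f : LaurentPoly K N M) (β : Fin M →₀ ℕ) :
    (embed M ω f).coeff β = laurentToSeries K ω (f.coeff β) :=
  MvPolynomial.coeff_map _ _ _

theorem embed_term (n : Fin N → ℤ) (β : Fin M →₀ ℕ) (c : K) :
    embed M ω (term n β c) = MvPolynomial.monomial β (mono ω (toQ n) c) := by
  rw [embed, term, MvPolynomial.map_monomial]
  exact congrArg _ (laurentToSeries_single n c)

theorem weight_eq (η : Fin M → WithTop ℝ) (n : Fin N → ℤ) (β : Fin M →₀ ℕ) :
    weight ω η n β = ((Expo.of ω (toQ n)).wt : WithTop ℝ) + yWeight η β := by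
  simp [weight, Expo.wt, pairing, yWeight, toQ]

theorem embed_mem_polySub {η : Fin M → WithTop ℝ} {S : Set (WithTop ℝ)} {f : LaurentPoly K N M}
    (h : ∀ β n, (f.coeff β).coeff n ≠ 0 → weight ω η n β ∈ S) : embed M ω f ∈ polySub K ω η S := by
  intro β α hα
  rw [coeff_embed] at hα
  obtain ⟨n, rfl, hn⟩ := exists_of_coeff_laurentToSeries_ne_zero hα
  rw [← weight_eq]
  exact h β n hn

theorem isSolution_iff {I : Ideal (LaurentPoly K N M)} {φ : Fin M → SOmega K ω} :
    IsSolution I φ ↔ ∀ f ∈ I, MvPolynomial.eval φ (embed M ω f) = 0 := by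
  have : extended ω I ≤ RingHom.ker (MvPolynomial.eval φ) ↔ _ := Ideal.map_le_iff_le_comap
  exact this

/-! ### Initial parts -/

theorem ordPol_le {η : Fin M → WithTop ℝ} {f : LaurentPoly K N M} {β : Fin M →₀ ℕ}
    {n : Fin N → ℤ} (h : (f.coeff β).coeff n ≠ 0) : ordPol ω η f ≤ weight ω η n β := by
  have h1 : β ∈ f.support := by
    rw [MvPolynomial.mem_support_iff]
    intro h0
    exact h (by simp [h0])
  exact (Finset.inf_le h1).trans (Finset.inf_le (Finsupp.mem_support_iff.2 h))

theorem le_ordPol {η : Fin M → WithTop ℝ} {f : LaurentPoly K N M} {m : WithTop ℝ}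
    (h : ∀ β n, (f.coeff β).coeff n ≠ 0 → m ≤ weight ω η n β) : m ≤ ordPol ω η f :=
  Finset.le_inf fun β _ => Finset.le_inf fun n hn => h β n (Finsupp.mem_support_iff.1 hn)

theorem coeff_coeff_term (n n' : Fin N → ℤ) (β β' : Fin M →₀ ℕ) (c : K) [Decidable (β = β')]
    [Decidable (n = n')] :
    ((term n β c : LaurentPoly K N M).coeff β').coeff n' =
      if β = β' then if n = n' then c else 0 else 0 := by
  classical
  rw [term, MvPolynomial.coeff_monomial]
  split_ifs with h1 h2
  · rw [h2, AddMonoidAlgebra.coeff_single, Finsupp.single_eq_same]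
  · rw [AddMonoidAlgebra.coeff_single, Finsupp.single_eq_of_ne (Ne.symm h2)]
  · rfl

open scoped Classical in
theorem coeff_inPol {η : Fin M → WithTop ℝ} {f : LaurentPoly K N M} (h : ordPol ω η f ≠ ⊤)
    (β : Fin M →₀ ℕ) (n : Fin N → ℤ) : ((inPol ω η f).coeff β).coeff n =
      if weight ω η n β = ordPol ω η f then (f.coeff β).coeff n else 0 := by
  rw [inPol, if_neg h]
  simp only [MvPolynomial.coeff_sum, AddMonoidAlgebra.coeff_sum, Finsupp.finsetSum_apply,
    coeff_coeff_term]
  rw [Finset.sum_eq_single β]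
  · simp only [if_true]
    rw [Finset.sum_ite_eq']
    simp only [Finset.mem_filter, Finsupp.mem_support_iff]
    split_ifs with h1 h2 h2
    · rfl
    · exact absurd h1.2 h2
    · by_contra h0
      exact h1 ⟨fun h' => h0 h'.symm, h2⟩
    · rfl
  · intro γ _ hγ
    simp [hγ]
  · intro hβ
    rw [MvPolynomial.notMem_support_iff] at hβ
    simp [hβ]

theorem embed_mem_ordPol (η : Fin M → WithTop ℝ) (f : LaurentPoly K N M) :
    embed M ω f ∈ polySub K ω η (Set.Ici (ordPol ω η f)) :=
  embed_mem_polySub fun _ _ h => ordPol_le h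

theorem embed_sub_embed_inPol_mem {η : Fin M → WithTop ℝ} {f : LaurentPoly K N M}
    (h : ordPol ω η f ≠ ⊤) :
    embed M ω f - embed M ω (inPol ω η f) ∈ polySub K ω η (Set.Ioi (ordPol ω η f)) := by
  classical
  intro β α hα
  rw [MvPolynomial.coeff_sub, coeff_embed, coeff_embed, ← map_sub (laurentToSeries K ω)] at hα
  obtain ⟨n, rfl, hn⟩ := exists_of_coeff_laurentToSeries_ne_zero hα
  rw [← weight_eq]
  rw [AddMonoidAlgebra.coeff_sub, Finsupp.sub_apply, coeff_inPol h] at hn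
  split_ifs at hn with h1
  · exact absurd (sub_self _) hn
  · rw [sub_zero] at hn
    exact lt_of_le_of_ne (ordPol_le hn) (Ne.symm h1)

theorem embed_inPol_mem (η : Fin M → WithTop ℝ) (f : LaurentPoly K N M) :
    embed M ω (inPol ω η f) ∈ polySub K ω η (Set.Iic (ordPol ω η f)) := by
  classical
  by_cases h : ordPol ω η f = ⊤
  · rw [inPol, if_pos h, map_zero]
    exact zero_mem _
  refine embed_mem_polySub fun β n hn => ?_
  rw [coeff_inPol h] at hn
  split_ifs at hn with h1
  · exact h1.le
  · exact absurd rfl hn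

/-- If the initial part of `f` vanishes at `φ`, then `f` has at `φ` a value of order greater than
the order of `f`. -/
theorem eval_mem_gtSub_of_eval_inPol {η : Fin M → WithTop ℝ} {φ : Fin M → SOmega K ω}
    (hφ : ∀ j, φ j ∈ geSub K ω (η j)) {f : LaurentPoly K N M}
    (h : MvPolynomial.eval φ (embed M ω (inPol ω η f)) = 0) :
    MvPolynomial.eval φ (embed M ω f) ∈ gtSub K ω (ordPol ω η f) := by
  by_cases htop : ordPol ω η f = ⊤
  · have h1 := eval_mem_geSub hφ (embed_mem_ordPol η f)
    rw [htop] at h1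
    rw [eq_zero_of_mem_geSub_top h1]
    exact zero_mem _
  · have := eval_mem_gtSub hφ (embed_sub_embed_inPol_mem htop)
    rwa [map_sub, h, sub_zero] at this

theorem eq_zero_of_mem_leSub_of_mem_gtSub {m : WithTop ℝ} {s : SOmega K ω}
    (h1 : s ∈ leSub K ω m) (h2 : s ∈ gtSub K ω m) : s = 0 := by
  ext α
  by_contra h0
  exact absurd (Set.mem_Iic.1 (h1 α h0)) (not_le.2 (Set.mem_Ioi.1 (h2 α h0)))

/-- The first terms of a solution of `I` solve the initial ideal. -/
theorem isSolution_initialIdeal (hω : LinearIndependent ℚ ω) {I : Ideal (LaurentPoly K N M)}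
    {c : Fin M → K} {a : Fin M → Fin N → ℚ} {ψ : Fin M → SOmega K ω} (hψ : IsSolution I ψ)
    (h : ∀ j, inser (ψ j) = mono ω (a j) (c j)) :
    IsSolution (initialIdeal ω (fun j => ordser (mono ω (a j) (c j))) I)
      (fun j => mono ω (a j) (c j)) := by
  set η : Fin M → WithTop ℝ := fun j => ordser (mono ω (a j) (c j))
  set φ : Fin M → SOmega K ω := fun j => mono ω (a j) (c j)
  have hge : ∀ j, φ j ∈ geSub K ω (η j) := fun j => mono_mem_weightSub_ordser Set.self_mem_Ici
  have hle : ∀ j, φ j ∈ leSub K ω (η j) := fun j => mono_mem_weightSub_ordser Set.self_mem_Iic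
  have hgt : ∀ j, ψ j - φ j ∈ gtSub K ω (η j) := fun j => sub_mem_gtSub_of_inser_eq hω (h j)
  rw [isSolution_iff]
  rw [isSolution_iff] at hψ
  suffices H : initialIdeal ω η I ≤
      RingHom.ker ((MvPolynomial.eval φ).comp (embed M ω)) from fun f hf => H hf
  rw [initialIdeal, Ideal.span_le]
  rintro _ (⟨f, hf, rfl⟩ | ⟨j, hj, rfl⟩)
  · change MvPolynomial.eval φ (embed M ω (inPol ω η f)) = 0
    by_cases htop : ordPol ω η f = ⊤
    · rw [inPol, if_pos htop, map_zero, map_zero]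
    refine eq_zero_of_mem_leSub_of_mem_gtSub (eval_mem_leSub hle (embed_inPol_mem η f)) ?_
    -- modulo terms of greater weight, `In f (φ)` is `f(φ)`, and `f(φ)` is `f(ψ) = 0`
    have h1 := eval_mem_gtSub hge (embed_sub_embed_inPol_mem htop)
    have h2 := eval_sub_eval_mem_gtSub hge hgt (embed_mem_ordPol η f)
    rw [hψ f hf] at h2
    rw [map_sub] at h1
    have h3 := neg_mem (add_mem h1 h2)
    have h4 : -(MvPolynomial.eval φ (embed M ω f) - MvPolynomial.eval φ (embed M ω (inPol ω η f)) +
      (0 - MvPolynomial.eval φ (embed M ω f))) =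
        MvPolynomial.eval φ (embed M ω (inPol ω η f)) := by ring
    rwa [h4] at h3
  · change MvPolynomial.eval φ (embed M ω (MvPolynomial.X j)) = 0
    rw [MvPolynomial.map_X, MvPolynomial.eval_X]
    have h1 := hge j
    rw [show η j = ⊤ from hj] at h1
    exact eq_zero_of_mem_geSub_top h1

/-- A monomial solution of the initial ideal keeps monomials in the variables of finite weight out
of that ideal. -/
theorem mem_tropicalVariety (hω : LinearIndependent ℚ ω) {I : Ideal (LaurentPoly K N M)}
    {φ : Fin M → SOmega K ω}
    (h : IsSolution (initialIdeal ω (fun j => ordser (φ j)) I) φ) :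
    (ω, fun j => ordser (φ j)) ∈ tropicalVariety I := by
  intro n β b hb hsupp hmem
  have : NoZeroDivisors (SOmega K ω) := ⟨SOmega.eq_zero_or_eq_zero hω⟩
  have := nontrivial_SOmega (K := K) (ω := ω)
  have h0 := isSolution_iff.1 h _ hmem
  rw [embed_term, MvPolynomial.eval_monomial] at h0
  rcases mul_eq_zero.1 h0 with h1 | h1
  · classical
    have := congrArg (fun s : SOmega K ω => s.1.coeff (Expo.of ω (toQ n))) h1
    simp only [coeff_mono, if_true] at this
    exact hb this
  · obtain ⟨j, hj, h2⟩ := Finset.prod_eq_zero_iff.1 h1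
    have h3 : j ∈ (term n β b : LaurentPoly K N M).vars := by
      rw [term, MvPolynomial.vars_monomial]
      · exact hj
      · simpa using hb
    have h4 := MvPolynomial.mem_supported.1 hsupp h3
    apply h4
    change ordser (φ j) = ⊤
    rw [eq_zero_of_pow_eq_zero h2, ordser_zero]

end Embed

/-! ### Approximating the extended ideal -/

section Approx

variable {ω : Fin N → ℝ}

/-- The polynomials `∑_ρ x^ρ f_ρ` with `f_ρ ∈ I`, the sum being over finitely many `ρ ∈ [0, 1)^N`.
Restricting `ρ` to these representatives of `ℚ^N / ℤ^N` prevents cancellation between summands. -/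
def fracSub (ω : Fin N → ℝ) (I : Ideal (LaurentPoly K N M)) :
    AddSubmonoid (MvPolynomial (Fin M) (SOmega K ω)) where
  carrier := {G | ∃ g : (Fin N → ℚ) →₀ LaurentPoly K N M, (∀ ρ, g ρ ∈ I) ∧
    (∀ ρ ∈ g.support, ∀ i, Int.fract (ρ i) = ρ i) ∧
    G = g.sum fun ρ f => MvPolynomial.C (mono ω ρ 1) * embed M ω f}
  zero_mem' := ⟨0, by simp, by simp, by simp⟩
  add_mem' := by
    classical
    rintro _ _ ⟨g, h1, h2, rfl⟩ ⟨g', h1', h2', rfl⟩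
    refine ⟨g + g', fun ρ => add_mem (h1 ρ) (h1' ρ), fun ρ hρ => ?_, ?_⟩
    · rcases Finset.mem_union.1 (Finsupp.support_add hρ) with h | h
      exacts [h2 ρ h, h2' ρ h]
    · rw [Finsupp.sum_add_index']
      · intro ρ
        rw [map_zero, mul_zero]
      · intro ρ f f'
        rw [map_add, mul_add]

theorem C_mono_mul_embed_mem_fracSub {I : Ideal (LaurentPoly K N M)} {f : LaurentPoly K N M}
    (hf : f ∈ I) (a : Fin N → ℚ) (c : K) :
    MvPolynomial.C (mono ω a c) * embed M ω f ∈ fracSub ω I := by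
  classical
  refine ⟨Finsupp.single (fun i => Int.fract (a i)) (term (fun i => ⌊a i⌋) 0 c * f), ?_, ?_, ?_⟩
  · intro ρ
    rw [Finsupp.single_apply]
    split_ifs
    · exact I.mul_mem_left _ hf
    · exact zero_mem _
  · intro ρ hρ i
    rw [Finset.mem_singleton.1 (Finsupp.support_single_subset hρ), Int.fract_fract]
  · rw [Finsupp.sum_single_index (by rw [map_zero, mul_zero]), map_mul, embed_term,
      MvPolynomial.monomial_zero', ← mul_assoc, ← MvPolynomial.C_mul, mono_mul_mono, one_mul]
    congr 3
    funext i
    exact (Int.fract_add_floor (a i)).symm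

/-- Terms of large weight can be removed from a series, leaving a finite sum of monomials. -/
theorem exists_truncation (hω : LinearIndependent ℚ ω) (s : SOmega K ω) (C : ℝ) :
    ∃ E : Finset (Fin N → ℚ),
      s - ∑ a ∈ E, mono ω a (s.1.coeff (Expo.of ω a)) ∈ gtSub K ω (C : WithTop ℝ) := by
  classical
  have hfin := IsPositivePuiseux.finite_le hω s.2 C
  refine ⟨hfin.toFinset, fun β hβ => ?_⟩
  rw [Set.mem_Ioi, WithTop.coe_lt_coe]
  by_contra! hle
  refine hβ ?_
  change s.1.coeff β - (∑ a ∈ hfin.toFinset, mono ω a (s.1.coeff (Expo.of ω a))).1.coeff β = 0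
  rw [coeff_sum, sub_eq_zero]
  obtain ⟨b, rfl⟩ := (Expo.of ω).surjective β
  simp only [coeff_mono, EmbeddingLike.apply_eq_iff_eq]
  rw [Finset.sum_ite_eq]
  split_ifs with h
  · rfl
  · by_contra h0
    exact h (hfin.mem_toFinset.2 ⟨h0, hle⟩)

theorem exists_real_embed_mem (η : Fin M → WithTop ℝ) (f : LaurentPoly K N M) :
    ∃ b : ℝ, embed M ω f ∈ polySub K ω η (Set.Ici (b : WithTop ℝ)) := by
  have h := embed_mem_ordPol (ω := ω) η f
  cases hm : ordPol ω η f with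
  | top =>
    refine ⟨0, fun β α hα => ?_⟩
    have := h β α hα
    rw [hm] at this
    exact Set.mem_Ici.2 (le_top.trans this)
  | coe b => exact ⟨b, hm ▸ h⟩

theorem exists_fracSub_approx_C_mul (hω : LinearIndependent ℚ ω) (η : Fin M → WithTop ℝ)
    {I : Ideal (LaurentPoly K N M)} (s : SOmega K ω) {f : LaurentPoly K N M} (hf : f ∈ I) (m : ℝ) :
    ∃ G ∈ fracSub ω I, MvPolynomial.C s * embed M ω f - G ∈
      polySub K ω η (Set.Ioi (m : WithTop ℝ)) := by
  obtain ⟨b, hb⟩ := exists_real_embed_mem (ω := ω) η f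
  obtain ⟨E, hE⟩ := exists_truncation hω s (m - b)
  refine ⟨MvPolynomial.C (∑ a ∈ E, mono ω a (s.1.coeff (Expo.of ω a))) * embed M ω f, ?_, ?_⟩
  · rw [map_sum, Finset.sum_mul]
    exact sum_mem fun a _ => C_mono_mul_embed_mem_fracSub hf _ _
  · have hsub : ∀ t : SOmega K ω, MvPolynomial.C s * embed M ω f - MvPolynomial.C t * embed M ω f =
        MvPolynomial.C (s - t) * embed M ω f := fun t => by
      rw [MvPolynomial.C_sub]
      ring
    rw [hsub]
    refine mul_mem_polySub (C_mem_polySub hE) hb fun x hx y hy => ?_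
    rw [Set.mem_Ioi] at hx ⊢
    rw [Set.mem_Ici] at hy
    cases x with
    | top => simp
    | coe x =>
      cases y with
      | top => simp
      | coe y =>
        norm_cast at *
        linarith

/-- The extension of `I` to `S_ω[y]` is additively generated by the products `s f`, `s ∈ S_ω`,
`f ∈ I`. -/
theorem extended_le_closure (I : Ideal (LaurentPoly K N M)) {H : MvPolynomial (Fin M) (SOmega K ω)}
    (hH : H ∈ extended ω I) :
    H ∈ AddSubmonoid.closure {G | ∃ s : SOmega K ω, ∃ f ∈ I, G = MvPolynomial.C s * embed M ω f} := by
  refine Submodule.span_induction ?_ (zero_mem _) (fun _ _ _ _ => add_mem) ?_ hH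
  · rintro _ ⟨f, hf, rfl⟩
    refine AddSubmonoid.subset_closure ⟨1, f, hf, ?_⟩
    rw [MvPolynomial.C_1, one_mul]
  · intro p x hxI hx
    rw [smul_eq_mul]
    clear hxI
    induction hx using AddSubmonoid.closure_induction with
    | mem x hx =>
      obtain ⟨s, f, hf, rfl⟩ := hx
      rw [← MvPolynomial.support_sum_monomial_coeff p, Finset.sum_mul]
      refine sum_mem fun β _ => AddSubmonoid.subset_closure
        ⟨p.coeff β * s, term 0 β 1 * f, I.mul_mem_left _ hf, ?_⟩
      have h0 : toQ (0 : Fin N → ℤ) = 0 := by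
        funext i
        simp [toQ]
      have h1 : embed M ω (term 0 β (1 : K) * f) = MvPolynomial.monomial β 1 * embed M ω f := by
        rw [RingHom.map_mul, embed_term, h0, mono_zero_one]
      rw [h1, ← mul_one (p.coeff β), ← MvPolynomial.C_mul_monomial, mul_one, MvPolynomial.C_mul]
      ring
    | zero => rw [mul_zero]; exact zero_mem _
    | add x y _ _ hx hy => rw [mul_add]; exact add_mem hx hy

theorem exists_fracSub_approx (hω : LinearIndependent ℚ ω) (η : Fin M → WithTop ℝ)
    {I : Ideal (LaurentPoly K N M)} {H : MvPolynomial (Fin M) (SOmega K ω)}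
    (hH : H ∈ extended ω I) (m : ℝ) :
    ∃ G ∈ fracSub ω I, H - G ∈ polySub K ω η (Set.Ioi (m : WithTop ℝ)) := by
  replace hH := extended_le_closure I hH
  induction hH using AddSubmonoid.closure_induction with
  | mem x hx =>
    obtain ⟨s, f, hf, rfl⟩ := hx
    exact exists_fracSub_approx_C_mul hω η s hf m
  | zero => exact ⟨0, zero_mem _, by simp⟩
  | add x y _ _ hx hy =>
    obtain ⟨G, h1, h2⟩ := hx
    obtain ⟨G', h1', h2'⟩ := hy
    refine ⟨G + G', add_mem h1 h1', ?_⟩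
    have hsub : x + y - (G + G') = (x - G) + (y - G') := by ring
    rw [hsub]
    exact add_mem h2 h2'

/-- In `∑_ρ x^ρ f_ρ`, `ρ ∈ [0, 1)^N`, the terms of the summands do not cancel. -/
theorem coeff_fracSum {g : (Fin N → ℚ) →₀ LaurentPoly K N M}
    (hg : ∀ ρ ∈ g.support, ∀ i, Int.fract (ρ i) = ρ i) {ρ : Fin N → ℚ} (hρ : ρ ∈ g.support)
    (β : Fin M →₀ ℕ) (n : Fin N → ℤ) :
    ((g.sum fun ρ f => MvPolynomial.C (mono ω ρ (1 : K)) * embed M ω f).coeff β).1.coeff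
      (Expo.of ω (toQ n) + Expo.of ω ρ) = ((g ρ).coeff β).coeff n := by
  rw [Finsupp.sum, MvPolynomial.coeff_sum, coeff_sum]
  simp only [MvPolynomial.coeff_C_mul, coeff_embed]
  rw [Finset.sum_eq_single ρ]
  · rw [coeff_mono_mul, one_mul, coeff_laurentToSeries]
  · intro σ hσ hne
    by_contra h0
    rw [coeff_mono_mul', one_mul] at h0
    obtain ⟨n', h1, -⟩ := exists_of_coeff_laurentToSeries_ne_zero h0
    refine hne ?_
    rw [← map_add, ← map_sub, EmbeddingLike.apply_eq_iff_eq] at h1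
    funext i
    have h2 : (n i : ℚ) + ρ i - σ i = n' i := congrFun h1 i
    rw [← hg σ hσ i, ← hg ρ hρ i, Int.fract_eq_fract]
    exact ⟨n i - n' i, by push_cast; linarith⟩
  · exact fun h => absurd hρ h

/-- If `φ` solves the initial ideal of `I`, then the elements of the extension of `I` do not attain
their order at `φ`. -/
theorem notMem_regularAt (hω : LinearIndependent ℚ ω) {I : Ideal (LaurentPoly K N M)}
    {η : Fin M → WithTop ℝ} {φ : Fin M → SOmega K ω} (hφ : ∀ j, φ j ∈ geSub K ω (η j))
    (hsol : IsSolution (initialIdeal ω η I) φ) {H : MvPolynomial (Fin M) (SOmega K ω)}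
    (hH : H ∈ extended ω I) : H ∉ regularAt hω η φ hφ := by
  rintro ⟨α, h1, h2⟩
  obtain ⟨G, ⟨g, hgI, hg, hG⟩, hHG⟩ := exists_fracSub_approx hω η hH α.wt
  have hGge : G ∈ polySub K ω η (Set.Ici (α.wt : WithTop ℝ)) := by
    have h3 : H - G ∈ polySub K ω η (Set.Ici (α.wt : WithTop ℝ)) := fun β γ h =>
      Set.mem_Ici.2 (Set.mem_Ioi.1 (hHG β γ h)).le
    have hsub : G = H - (H - G) := by ring
    rw [hsub]
    exact sub_mem h1 h3
  have hgt : MvPolynomial.eval φ G ∈ gtSub K ω (α.wt : WithTop ℝ) := by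
    rw [hG, Finsupp.sum, map_sum]
    refine sum_mem fun ρ hρ => ?_
    rw [map_mul, MvPolynomial.eval_C]
    have h4 : MvPolynomial.eval φ (embed M ω (g ρ)) ∈ gtSub K ω (ordPol ω η (g ρ)) :=
      eval_mem_gtSub_of_eval_inPol hφ
        (isSolution_iff.1 hsol _ (Ideal.subset_span (Or.inl ⟨g ρ, hgI ρ, rfl⟩)))
    have h5 : ((α.wt - (Expo.of ω ρ).wt : ℝ) : WithTop ℝ) ≤ ordPol ω η (g ρ) := by
      refine le_ordPol fun β n hn => ?_
      rw [← coeff_fracSum (ω := ω) hg hρ, ← hG] at hn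
      have h6 := Set.mem_Ici.1 (hGge β _ hn)
      rw [Expo.wt_add] at h6
      rw [weight_eq]
      cases hy : yWeight η β with
      | top => simp
      | coe y =>
        rw [hy] at h6
        norm_cast at *
        linarith
    have h6 := mul_mem_gtSub' (mono_mem_weightSub (a := ρ) Set.self_mem_Ici (1 : K))
      (gtSub_anti h5 h4)
    rwa [← WithTop.coe_add, add_sub_cancel] at h6
  have h7 := add_mem (eval_mem_gtSub hφ hHG) hgt
  rw [map_sub, sub_add_cancel] at h7
  exact lt_irrefl _ (Set.mem_Ioi.1 (h7 α h2))

end Approx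

/-! ### Finiteness of the set of solutions -/

section Finiteness

/-- The image on spectra of an injective ring map of finite presentation contains a nonempty
basic open set. -/
theorem exists_basicOpen_subset_range_comap {R S : Type*} [CommRing R] [IsDomain R] [CommRing S]
    {f : R →+* S} (hf : f.FinitePresentation) (hinj : Function.Injective f) :
    ∃ h : R, h ≠ 0 ∧ ∀ p : PrimeSpectrum R, h ∉ p.asIdeal →
      ∃ q : PrimeSpectrum S, q.asIdeal.comap f = p.asIdeal := by
  obtain ⟨D, hD⟩ := PrimeSpectrum.exists_constructibleSetData_iff.2
    (PrimeSpectrum.isConstructible_range_comap hf)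
  -- the generic point of `Spec R` is in the image, so one of the locally closed pieces is dense
  obtain ⟨q, hq, hq'⟩ := Ideal.exists_comap_eq_of_mem_minimalPrimes_of_injective hinj ⊥
    (by rw [IsDomain.minimalPrimes_eq_singleton_bot]; rfl)
  have hgen : (⟨⊥, Ideal.isPrime_bot⟩ : PrimeSpectrum R) ∈ D.toSet := by
    rw [hD]
    exact ⟨⟨q, hq⟩, PrimeSpectrum.ext hq'⟩
  obtain ⟨C, hC, hCmem⟩ := Set.mem_iUnion₂.1 hgen
  have hg : ∀ i, C.g i = 0 := fun i => (hCmem.1 ⟨i, rfl⟩ : C.g i ∈ (⊥ : Ideal R))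
  have hne : C.f ≠ 0 := fun h => hCmem.2 (by
    rw [h]
    exact Set.singleton_subset_iff.2 (zero_mem (⊥ : Ideal R)))
  refine ⟨C.f, hne, fun p hp => ?_⟩
  have hmem : p ∈ Set.range (PrimeSpectrum.comap f) := by
    rw [← hD]
    refine Set.mem_iUnion₂.2 ⟨C, hC, ?_, fun h => hp (h rfl)⟩
    rintro _ ⟨i, rfl⟩
    rw [hg i]
    exact zero_mem p.asIdeal
  obtain ⟨q, hq⟩ := hmem
  exact ⟨q, congrArg PrimeSpectrum.asIdeal hq⟩

/-- The inclusion `K[x][T] → K[x, y]` that sends `T` to `y_j`. -/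
def elimHom (K : Type*) [Field K] (N : ℕ) {M : ℕ} (j : Fin M) :
    Polynomial (MvPolynomial (Fin N) K) →+* MvPolynomial (Fin N ⊕ Fin M) K :=
  Polynomial.eval₂RingHom (MvPolynomial.rename Sum.inl).toRingHom (MvPolynomial.X (Sum.inr j))

theorem elimHom_C (j : Fin M) (p : MvPolynomial (Fin N) K) :
    elimHom K N j (Polynomial.C p) = MvPolynomial.rename Sum.inl p :=
  Polynomial.eval₂_C _ _

theorem elimHom_X (j : Fin M) :
    elimHom K N j Polynomial.X = MvPolynomial.X (Sum.inr j) :=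
  Polynomial.eval₂_X _ _

theorem elimHom_comp_finitePresentation (J : Ideal (MvPolynomial (Fin N ⊕ Fin M) K)) (j : Fin M) :
    ((Ideal.Quotient.mk J).comp (elimHom K N j)).FinitePresentation := by
  rw [← RingHom.FinitePresentation.of_finiteType]
  refine RingHom.FiniteType.of_comp_finiteType
    (f := (Polynomial.C : MvPolynomial (Fin N) K →+* _).comp (MvPolynomial.C : K →+* _)) ?_
  have : ((Ideal.Quotient.mk J).comp (elimHom K N j)).comp
      ((Polynomial.C : MvPolynomial (Fin N) K →+* _).comp (MvPolynomial.C : K →+* _)) =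
      algebraMap K (MvPolynomial (Fin N ⊕ Fin M) K ⧸ J) := by
    ext c
    change Ideal.Quotient.mk J (elimHom K N j (Polynomial.C (MvPolynomial.C c))) = _
    rw [elimHom_C, MvPolynomial.rename_C]
    rfl
  rw [this, RingHom.finiteType_algebraMap]
  infer_instance

/-- If the generic fibres of `V(J) → K^N` are finite, then every `y_j` is algebraic over `K(x)`
modulo `J`. -/
theorem exists_elimHom_mem [IsAlgClosed K] {J : Ideal (MvPolynomial (Fin N ⊕ Fin M) K)}
    {g : MvPolynomial (Fin N) K} (hg : g ≠ 0)
    (hfin : ∀ a : Fin N → K, MvPolynomial.eval a g ≠ 0 → (fiber J a).Finite) (j : Fin M) :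
    ∃ p : Polynomial (MvPolynomial (Fin N) K), p ≠ 0 ∧ elimHom K N j p ∈ J := by
  by_contra! hcon
  have hinj : Function.Injective ((Ideal.Quotient.mk J).comp (elimHom K N j)) := by
    rw [injective_iff_map_eq_zero]
    intro p hp
    by_contra hp0
    exact hcon p hp0 (Ideal.Quotient.eq_zero_iff_mem.1 hp)
  obtain ⟨h, hh, hlift⟩ := exists_basicOpen_subset_range_comap
    (elimHom_comp_finitePresentation J j) hinj
  obtain ⟨k, hk⟩ : ∃ k, h.coeff k ≠ 0 := by
    by_contra! h0
    exact hh (Polynomial.ext h0)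
  obtain ⟨a, ha⟩ : ∃ a : Fin N → K, MvPolynomial.eval a (h.coeff k * g) ≠ 0 := by
    by_contra! h0
    exact mul_ne_zero hk hg (MvPolynomial.funext fun a => by rw [h0, map_zero])
  rw [map_mul] at ha
  have hha : h.map (MvPolynomial.eval a) ≠ 0 := fun h0 => left_ne_zero_of_mul ha (by
    rw [← Polynomial.coeff_map, h0, Polynomial.coeff_zero])
  -- all but finitely many `t ∈ K` are the `y_j`-coordinate of a point of the fibre over `a`
  have hsub : {t | (h.map (MvPolynomial.eval a)).eval t ≠ 0} ⊆
      (fun z => z (Sum.inr j)) '' fiber J a := by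
    intro t ht
    set ε : Polynomial (MvPolynomial (Fin N) K) →+* K :=
      Polynomial.eval₂RingHom (MvPolynomial.eval a) t
    have hε : h ∉ RingHom.ker ε := by
      rw [RingHom.mem_ker]
      change Polynomial.eval₂ _ _ _ ≠ 0
      rw [← Polynomial.eval_map]
      exact ht
    obtain ⟨q, hq⟩ := hlift ⟨RingHom.ker ε, RingHom.ker_isPrime ε⟩ hε
    obtain ⟨n, hn, hqn⟩ := Ideal.exists_le_maximal (q.asIdeal.comap (Ideal.Quotient.mk J))
      (Ideal.IsPrime.ne_top (Ideal.IsPrime.comap _ (hK := q.2)))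
    obtain ⟨z, hz⟩ := MvPolynomial.eq_vanishingIdeal_singleton_of_isMaximal K hn
    have hker : ∀ p, ε p = 0 → MvPolynomial.aeval z (elimHom K N j p) = 0 := by
      intro p hp
      rw [← MvPolynomial.mem_vanishingIdeal_singleton_iff, ← hz]
      refine hqn ?_
      have : p ∈ q.asIdeal.comap ((Ideal.Quotient.mk J).comp (elimHom K N j)) := by
        rw [hq]
        exact hp
      exact this
    refine ⟨z, ⟨fun p hp => ?_, funext fun i => ?_⟩, ?_⟩
    · rw [← MvPolynomial.mem_vanishingIdeal_singleton_iff, ← hz]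
      refine hqn ?_
      rw [Ideal.mem_comap, Ideal.Quotient.eq_zero_iff_mem.2 hp]
      exact zero_mem _
    · have := hker (Polynomial.C (MvPolynomial.X i - MvPolynomial.C (a i))) (by simp [ε])
      rw [elimHom_C] at this
      simpa [sub_eq_zero] using this
    · have := hker (Polynomial.X - Polynomial.C (MvPolynomial.C t)) (by simp [ε])
      rw [map_sub, elimHom_C, elimHom_X] at this
      simpa [sub_eq_zero] using this
  have h1 : {t | (h.map (MvPolynomial.eval a)).eval t ≠ 0}.Finite :=
    ((hfin a (right_ne_zero_of_mul ha)).image _).subset hsub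
  have h2 : {t | (h.map (MvPolynomial.eval a)).eval t = 0}.Finite :=
    Polynomial.finite_setOfPred_isRoot hha
  have := h1.union h2
  refine Set.infinite_univ (α := K) (this.subset fun t _ => ?_)
  by_cases h0 : (h.map (MvPolynomial.eval a)).eval t = 0
  · exact Or.inr h0
  · exact Or.inl h0

variable {ω : Fin N → ℝ}

/-- The inclusion `K[x] → S_ω`. -/
def polyToSeries (K : Type*) [Field K] (ω : Fin N → ℝ) : MvPolynomial (Fin N) K →ₐ[K] SOmega K ω :=
  MvPolynomial.aeval fun i => mono ω (toQ (Pi.single i 1)) 1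

theorem polyToSeries_X (i : Fin N) :
    polyToSeries K ω (MvPolynomial.X i) = mono ω (toQ (Pi.single i 1)) 1 :=
  MvPolynomial.aeval_X _ _

theorem prod_mono {ι : Type*} (s : Finset ι) (a : ι → Fin N → ℚ) :
    ∏ i ∈ s, mono ω (a i) (1 : K) = mono ω (∑ i ∈ s, a i) 1 := by
  classical
  induction s using Finset.induction_on with
  | empty => rfl
  | insert i s hi ih =>
    rw [Finset.prod_insert hi, Finset.sum_insert hi, ih, mono_mul_mono, one_mul]

theorem mono_pow (a : Fin N → ℚ) (n : ℕ) : mono ω a (1 : K) ^ n = mono ω (n • a) 1 := by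
  rw [← Finset.card_range n, ← Finset.prod_const, prod_mono, Finset.sum_const]

theorem polyToSeries_injective : Function.Injective (polyToSeries K ω) := by
  classical
  rw [injective_iff_map_eq_zero]
  intro p hp
  ext s
  have hprod : ∀ s : Fin N →₀ ℕ, ∏ i, mono ω (toQ (Pi.single i 1)) (1 : K) ^ s i =
      mono ω (fun i => (s i : ℚ)) 1 := by
    intro s
    simp only [mono_pow, prod_mono]
    congr 1
    funext i
    rw [Finset.sum_apply, Finset.sum_eq_single i]
    · simp [toQ]
    · intro k _ hk
      simp [toQ, Pi.single_eq_of_ne hk.symm]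
    · simp
  have h := congrArg (fun t : SOmega K ω => t.1.coeff (Expo.of ω fun i => (s i : ℚ))) hp
  simp only [polyToSeries, MvPolynomial.aeval_def, MvPolynomial.eval₂_eq', hprod, coeff_sum] at h
  rw [Finset.sum_eq_single s] at h
  · rw [← Algebra.smul_def, smul_mono, mul_one, coeff_mono, if_pos rfl] at h
    exact h
  · intro t _ hts
    rw [← Algebra.smul_def, smul_mono, coeff_mono, if_neg]
    intro h'
    rw [EmbeddingLike.apply_eq_iff_eq] at h'
    refine hts (Finsupp.ext fun i => ?_)
    exact_mod_cast (congrFun h' i).symm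
  · intro hs
    rw [MvPolynomial.notMem_support_iff.1 hs, map_zero, zero_mul]
    rfl

theorem polyToLaurent_C (c : K) : polyToLaurent K N M (MvPolynomial.C c) =
    MvPolynomial.C (algebraMap K (Laurent K N) c) :=
  (polyToLaurent K N M).commutes c

theorem polyToLaurent_X_inl (i : Fin N) :
    polyToLaurent K N M (MvPolynomial.X (Sum.inl i)) = term (Pi.single i 1) 0 1 :=
  MvPolynomial.aeval_X _ _

theorem polyToLaurent_X_inr (j : Fin M) :
    polyToLaurent K N M (MvPolynomial.X (Sum.inr j)) = MvPolynomial.X j :=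
  MvPolynomial.aeval_X _ _

theorem embed_C (a : Laurent K N) :
    embed M ω (MvPolynomial.C a) = MvPolynomial.C (laurentToSeries K ω a) :=
  MvPolynomial.map_C _ _

theorem embed_X (j : Fin M) :
    embed M ω (MvPolynomial.X j : LaurentPoly K N M) = MvPolynomial.X j :=
  MvPolynomial.map_X _ _

theorem eval_embed_elimHom (ψ : Fin M → SOmega K ω) (j : Fin M)
    (p : Polynomial (MvPolynomial (Fin N) K)) :
    MvPolynomial.eval ψ (embed M ω (polyToLaurent K N M (elimHom K N j p))) =
      (p.map (polyToSeries K ω).toRingHom).eval (ψ j) := by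
  rw [Polynomial.eval_map]
  suffices H : ((MvPolynomial.eval ψ).comp (embed M ω)).comp
      ((polyToLaurent K N M).toRingHom.comp (elimHom K N j)) =
      Polynomial.eval₂RingHom (polyToSeries K ω).toRingHom (ψ j) from RingHom.congr_fun H p
  refine Polynomial.ringHom_ext' (MvPolynomial.ringHom_ext ?_ ?_) ?_
  · intro c
    simp only [RingHom.comp_apply, Polynomial.coe_eval₂RingHom, elimHom_C, Polynomial.eval₂_C,
      AlgHom.toRingHom_eq_coe, RingHom.coe_coe, MvPolynomial.rename_C, polyToLaurent_C, embed_C,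
      MvPolynomial.eval_C, AlgHom.commutes]
    exact ((polyToSeries K ω).commutes c).symm
  · intro i
    simp only [RingHom.comp_apply, Polynomial.coe_eval₂RingHom, elimHom_C, Polynomial.eval₂_C,
      AlgHom.toRingHom_eq_coe, RingHom.coe_coe, MvPolynomial.rename_X, polyToLaurent_X_inl,
      embed_term, MvPolynomial.monomial_zero', MvPolynomial.eval_C]
    exact (polyToSeries_X i).symm
  · have h : MvPolynomial.eval ψ (embed M ω (polyToLaurent K N M
        (elimHom K N j Polynomial.X))) = ψ j := by
      rw [elimHom_X, polyToLaurent_X_inr, embed_X, MvPolynomial.eval_X]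
    exact h.trans (Polynomial.eval₂_X _ _).symm

/-- An admissible ideal has only finitely many solutions. -/
theorem finite_setOf_isSolution [IsAlgClosed K] (hω : LinearIndependent ℚ ω)
    {I : Ideal (LaurentPoly K N M)} (hI : IsAdmissible I) :
    {ψ : Fin M → SOmega K ω | IsSolution I ψ}.Finite := by
  obtain ⟨-, g, hg, hfin⟩ := hI
  have : NoZeroDivisors (SOmega K ω) := ⟨SOmega.eq_zero_or_eq_zero hω⟩
  have hj : ∀ j : Fin M, ∃ S : Set (SOmega K ω), S.Finite ∧ ∀ ψ, IsSolution I ψ → ψ j ∈ S := by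
    intro j
    obtain ⟨p, hp, hpJ⟩ := exists_elimHom_mem hg hfin j
    have hp' : p.map (polyToSeries K ω).toRingHom ≠ 0 :=
      (Polynomial.map_ne_zero_iff polyToSeries_injective).2 hp
    have : IsDomain (SOmega K ω) :=
      have := nontrivial_SOmega (K := K) (ω := ω)
      NoZeroDivisors.to_isDomain _
    refine ⟨_, Polynomial.finite_setOfPred_isRoot hp', fun ψ hψ => ?_⟩
    change Polynomial.eval _ _ = 0
    rw [← eval_embed_elimHom ψ j p]
    exact isSolution_iff.1 hψ _ hpJ
  choose S hS hψ using hj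
  exact (Set.Finite.pi' hS).subset fun ψ h j => hψ j ψ h

end Finiteness

/-! ### Exponents of nonnegative weight -/

section Generators

variable {ω : Fin N → ℝ}

theorem pairing_sub (ω : Fin N → ℝ) (α β : Fin N → ℚ) :
    pairing ω (α - β) = pairing ω α - pairing ω β := by
  have := pairing_add ω (α - β) β
  rw [sub_add_cancel] at this
  linarith

theorem pairing_zero (ω : Fin N → ℝ) : pairing ω 0 = 0 := by
  simp [pairing]

theorem eq_zero_of_pairing_eq_zero (hω : LinearIndependent ℚ ω) {α : Fin N → ℚ}
    (h : pairing ω α = 0) : α = 0 :=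
  pairing_injective hω (h.trans (pairing_zero ω).symm)

theorem exists_sum_of_mem_rationalCone {s : Finset (Fin N → ℚ)} {x : Fin N → ℝ}
    (hx : x ∈ rationalCone s) :
    ∃ t : (Fin N → ℚ) → ℝ, (∀ v, 0 ≤ t v) ∧ x = ∑ v ∈ s, t v • toRealVec v := by
  classical
  induction hx using Submodule.span_induction with
  | mem x hx =>
    obtain ⟨v, hv, rfl⟩ := hx
    refine ⟨Pi.single v 1, fun w => ?_, ?_⟩
    · by_cases h : w = v
      · subst h; simp
      · simp [h]
    · rw [Finset.sum_eq_single v]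
      · simp
      · intro w _ hw
        simp [hw]
      · exact fun h => absurd hv h
  | zero => exact ⟨0, fun _ => le_rfl, by simp⟩
  | add x y _ _ hx hy =>
    obtain ⟨t, h1, rfl⟩ := hx
    obtain ⟨u, h2, rfl⟩ := hy
    exact ⟨t + u, fun v => add_nonneg (h1 v) (h2 v), by
      simp [add_smul, Finset.sum_add_distrib]⟩
  | smul a x _ hx =>
    obtain ⟨t, h1, rfl⟩ := hx
    refine ⟨(a : ℝ) • t, fun v => mul_nonneg a.2 (h1 v), ?_⟩
    rw [Finset.smul_sum]
    refine Finset.sum_congr rfl fun v _ => ?_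
    rw [Pi.smul_apply, smul_assoc]
    rfl

theorem sum_mem_rationalCone {s : Finset (Fin N → ℚ)} {t : (Fin N → ℚ) → ℝ}
    (ht : ∀ v ∈ s, 0 ≤ t v) : ∑ v ∈ s, t v • toRealVec v ∈ rationalCone s := by
  refine sum_mem fun v hv => ?_
  exact (rationalCone s).smul_mem (ht v hv) (Submodule.subset_span ⟨v, hv, rfl⟩)

theorem inLattice_finset (s : Finset (Fin N → ℚ)) : InLattice (s : Set (Fin N → ℚ)) := by
  classical
  induction s using Finset.induction_on with
  | empty => exact ⟨1, one_pos, by simp⟩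
  | insert v s _ ih =>
    obtain ⟨k, hk, h1, h2⟩ := (isPositivePuiseux_singleton (0 : Fin N → ℝ) v).1.add ih
    refine ⟨k, hk, fun α hα => ?_⟩
    rcases Finset.mem_insert.1 (Finset.mem_coe.1 hα) with rfl | h
    · exact h1 _ rfl
    · exact h2 α h

/-- The exponents of nonnegative weight in an `ω`-positive Puiseux set lie in a finitely generated
monoid of vectors of positive weight.  The generators are those of the cone and the exponents of
bounded weight: from an exponent of large weight a generator of the cone can be subtracted. -/
theorem IsPositivePuiseux.exists_generators (hω : LinearIndependent ℚ ω) {E : Set (Fin N → ℚ)}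
    (hE : IsPositivePuiseux ω E) : ∃ G : Finset (Fin N → ℚ), (∀ v ∈ G, 0 < pairing ω v) ∧
      ∀ α ∈ E, 0 ≤ pairing ω α → α ∈ AddSubmonoid.closure (G : Set (Fin N → ℚ)) := by
  classical
  obtain ⟨hlat, γ, s, hs, hcone⟩ := hE
  obtain ⟨k, hk, hkE, hks⟩ := hlat.add (inLattice_finset s)
  have hs' := (isPositiveCone_iff ω s).1 hs
  have hpos : ∀ v ∈ s, v ≠ 0 → 0 < pairing ω v := fun v hv hv0 =>
    lt_of_le_of_ne (hs' v hv) fun h => hv0 (eq_zero_of_pairing_eq_zero hω h.symm)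
  set P : Set (Fin N → ℚ) := {α | (∀ i, ∃ m : ℤ, α i = (m : ℚ) / k) ∧
    toRealVec (α + γ) ∈ rationalCone s}
  have hP : IsPositivePuiseux ω P := ⟨⟨k, hk, fun α hα => hα.1⟩, γ, s, hs, fun α hα => hα.2⟩
  set D : ℝ := ∑ v ∈ s, pairing ω v + |pairing ω γ|
  have hD0 : 0 ≤ D := add_nonneg (Finset.sum_nonneg hs') (abs_nonneg _)
  have hfin := hP.finite_le hω D
  set G : Finset (Fin N → ℚ) :=
    hfin.toFinset.filter (fun α => 0 < pairing ω α) ∪ s.filter (fun α => α ≠ 0)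
  have hmin : ∃ δ : ℝ, 0 < δ ∧ ∀ v ∈ s, v ≠ 0 → δ ≤ pairing ω v := by
    by_cases hne : (s.filter (fun α => α ≠ 0)).Nonempty
    · obtain ⟨v, hv, hmin⟩ := Finset.exists_min_image _ (pairing ω) hne
      rw [Finset.mem_filter] at hv
      exact ⟨pairing ω v, hpos v hv.1 hv.2, fun w hw hw0 =>
        hmin w (Finset.mem_filter.2 ⟨hw, hw0⟩)⟩
    · exact ⟨1, one_pos, fun v hv hv0 =>
        absurd ⟨v, Finset.mem_filter.2 ⟨hv, hv0⟩⟩ hne⟩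
  obtain ⟨δ, hδ, hmin⟩ := hmin
  have small : ∀ α ∈ P, 0 ≤ pairing ω α → pairing ω α ≤ D →
      α ∈ AddSubmonoid.closure (G : Set (Fin N → ℚ)) := by
    intro α hα h0 hle
    rcases h0.eq_or_lt with h | h
    · rw [eq_zero_of_pairing_eq_zero hω h.symm]
      exact zero_mem _
    · exact AddSubmonoid.subset_closure (Finset.mem_coe.2 (Finset.mem_union_left _
        (Finset.mem_filter.2 ⟨hfin.mem_toFinset.2 ⟨hα, hle⟩, h⟩)))
  have main : ∀ n : ℕ, ∀ α ∈ P, 0 ≤ pairing ω α → pairing ω α ≤ n * δ →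
      α ∈ AddSubmonoid.closure (G : Set (Fin N → ℚ)) := by
    intro n
    induction n with
    | zero =>
      intro α hα h0 hle
      refine small α hα h0 (hle.trans ?_)
      simpa using hD0
    | succ n ih =>
      intro α hα h0 hle
      by_cases hαD : pairing ω α ≤ D
      · exact small α hα h0 hαD
      rw [not_le] at hαD
      obtain ⟨t, ht0, ht⟩ := exists_sum_of_mem_rationalCone hα.2
      have hw : pairing ω α + pairing ω γ = ∑ v ∈ s, t v * pairing ω v := by
        rw [← pairing_add, ← dotProduct_toRealVec, ht, dotProduct_sum]
        refine Finset.sum_congr rfl fun v _ => ?_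
        rw [dotProduct_smul, smul_eq_mul, dotProduct_toRealVec]
      obtain ⟨v, hv, hv0, hv1⟩ : ∃ v ∈ s, v ≠ 0 ∧ 1 ≤ t v := by
        by_contra! hcon
        have : ∑ v ∈ s, t v * pairing ω v ≤ ∑ v ∈ s, pairing ω v := by
          refine Finset.sum_le_sum fun v hv => ?_
          rcases eq_or_ne v 0 with rfl | hv0
          · rw [pairing_zero, mul_zero]
          · exact mul_le_of_le_one_left (hs' v hv) (hcon v hv hv0).le
        have h3 := neg_abs_le (pairing ω γ)
        linarith
      have hvD : pairing ω v ≤ D :=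
        (Finset.single_le_sum hs' hv).trans (le_add_of_nonneg_right (abs_nonneg _))
      have hsub : α - v ∈ P := by
        refine ⟨fun i => ?_, ?_⟩
        · obtain ⟨m, hm⟩ := hα.1 i
          obtain ⟨m', hm'⟩ := hks v hv i
          exact ⟨m - m', by rw [Pi.sub_apply, hm, hm']; push_cast; ring⟩
        · have e : toRealVec (α - v + γ) =
              ∑ w ∈ s, (t w - if w = v then 1 else 0) • toRealVec w := by
            simp only [sub_smul, Finset.sum_sub_distrib, ← ht, ite_smul, one_smul, zero_smul,
              Finset.sum_ite_eq', if_pos hv]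
            rw [eq_sub_iff_add_eq, ← toRealVec_add]
            congr 1
            abel
          rw [e]
          refine sum_mem_rationalCone fun w _ => ?_
          split_ifs with h
          · rw [h]; linarith
          · rw [sub_zero]; exact ht0 w
      have hmem : v ∈ AddSubmonoid.closure (G : Set (Fin N → ℚ)) :=
        AddSubmonoid.subset_closure (Finset.mem_coe.2 (Finset.mem_union_right _
          (Finset.mem_filter.2 ⟨hv, hv0⟩)))
      rw [← sub_add_cancel α v]
      refine add_mem (ih _ hsub ?_ ?_) hmem
      · rw [pairing_sub]; linarith
      · rw [pairing_sub]
        have := hmin v hv hv0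
        push_cast at hle
        linarith
  refine ⟨G, fun v hv => ?_, fun α hα h0 => ?_⟩
  · rcases Finset.mem_union.1 hv with h | h
    · exact (Finset.mem_filter.1 h).2
    · exact hpos v (Finset.mem_filter.1 h).1 (Finset.mem_filter.1 h).2
  · obtain ⟨n, hn⟩ := exists_nat_ge (pairing ω α / δ)
    exact main n α ⟨hkE α hα, hcone α hα⟩ h0 ((div_le_iff₀ hδ).1 hn)

/-! ### Power series as series of nonnegative weight -/

variable {σ : Type*} [Fintype σ]

/-- The exponent `∑ d_i g_i` of the monomial `X^d` under the substitution `X_i ↦ x^(g_i)`. -/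
def expSum (g : σ → Fin N → ℚ) (d : σ →₀ ℕ) : Fin N → ℚ := ∑ i, d i • g i

theorem expSum_add (g : σ → Fin N → ℚ) (d e : σ →₀ ℕ) :
    expSum g (d + e) = expSum g d + expSum g e := by
  simp [expSum, add_smul, Finset.sum_add_distrib]

theorem expSum_zero (g : σ → Fin N → ℚ) : expSum g 0 = 0 := by
  simp [expSum]

theorem pairing_expSum (g : σ → Fin N → ℚ) (d : σ →₀ ℕ) :
    pairing ω (expSum g d) = ∑ i, (d i : ℝ) * pairing ω (g i) := by
  have h0 : ∀ (s : Finset σ) (f : σ → Fin N → ℚ),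
      pairing ω (∑ i ∈ s, f i) = ∑ i ∈ s, pairing ω (f i) := by
    classical
    intro s f
    induction s using Finset.induction_on with
    | empty => simp [pairing_zero]
    | insert i s hi ih => rw [Finset.sum_insert hi, Finset.sum_insert hi, pairing_add, ih]
  rw [expSum, h0]
  refine Finset.sum_congr rfl fun i _ => ?_
  simp only [pairing, Finset.mul_sum]
  refine Finset.sum_congr rfl fun k _ => ?_
  simp
  ring

theorem finite_expSum_eq {g : σ → Fin N → ℚ} (hg : ∀ i, 0 < pairing ω (g i)) (α : Fin N → ℚ) :
    {d : σ →₀ ℕ | expSum g d = α}.Finite := by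
  refine ((Set.Finite.pi' fun i => Set.finite_Iic ⌊pairing ω α / pairing ω (g i)⌋₊).preimage
    (f := fun d : σ →₀ ℕ => (d : σ → ℕ)) DFunLike.coe_injective.injOn).subset ?_
  intro d hd i
  change d i ≤ ⌊_⌋₊
  refine Nat.le_floor ?_
  rw [le_div_iff₀ (hg i), ← show expSum g d = α from hd, pairing_expSum]
  exact Finset.single_le_sum (f := fun i => (d i : ℝ) * pairing ω (g i))
    (fun i _ => mul_nonneg (Nat.cast_nonneg _) (hg i).le) (Finset.mem_univ i)

theorem isPositivePuiseux_range_expSum {g : σ → Fin N → ℚ} (hg : ∀ i, 0 < pairing ω (g i)) :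
    IsPositivePuiseux ω (Set.range (expSum g)) := by
  classical
  obtain ⟨k, hk, hkg⟩ := inLattice_finset (Finset.univ.image g)
  refine ⟨⟨k, hk, ?_⟩, 0, Finset.univ.image g, ?_, ?_⟩
  · rintro _ ⟨d, rfl⟩ i
    choose m hm using fun l => hkg (g l) (by simp) i
    refine ⟨∑ l, d l * m l, ?_⟩
    rw [expSum, Finset.sum_apply, Int.cast_sum, Finset.sum_div]
    refine Finset.sum_congr rfl fun l _ => ?_
    rw [Pi.smul_apply, hm l]
    push_cast
    rw [nsmul_eq_mul]
    ring
  · rw [isPositiveCone_iff]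
    intro v hv
    obtain ⟨i, -, rfl⟩ := Finset.mem_image.1 hv
    exact (hg i).le
  · rintro _ ⟨d, rfl⟩
    have : toRealVec (expSum g d + 0) = ∑ i, (d i : ℝ) • toRealVec (g i) := by
      funext k
      simp [toRealVec, expSum]
    rw [this]
    exact sum_mem fun i _ => (rationalCone _).smul_mem (Nat.cast_nonneg _)
      (Submodule.subset_span ⟨g i, by simp, rfl⟩)

/-- The monomials `X^d` that the substitution `X_i ↦ x^(g_i)` sends to `x^α`. -/
def expFiber {g : σ → Fin N → ℚ} (hg : ∀ i, 0 < pairing ω (g i)) (α : Fin N → ℚ) :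
    Finset (σ →₀ ℕ) := (finite_expSum_eq hg α).toFinset

theorem mem_expFiber {g : σ → Fin N → ℚ} (hg : ∀ i, 0 < pairing ω (g i)) {α : Fin N → ℚ}
    {d : σ →₀ ℕ} : d ∈ expFiber hg α ↔ expSum g d = α :=
  (finite_expSum_eq hg α).mem_toFinset

theorem exists_substFun (hω : LinearIndependent ℚ ω) {g : σ → Fin N → ℚ}
    (hg : ∀ i, 0 < pairing ω (g i)) (f : MvPowerSeries σ K) :
    ∃ s : SOmega K ω, ∀ α, s.1.coeff (Expo.of ω α) =
      ∑ d ∈ expFiber hg α, MvPowerSeries.coeff d f := by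
  rw [SOmega.exists_coeff_iff hω]
  refine (isPositivePuiseux_range_expSum hg).mono fun α hα => ?_
  obtain ⟨d, hd, -⟩ := Finset.exists_ne_zero_of_sum_ne_zero hα
  exact ⟨d, (mem_expFiber hg).1 hd⟩

/-- The substitution `X_i ↦ x^(g_i)` in a power series `f`, as a function of `f`. -/
def substFun (hω : LinearIndependent ℚ ω) {g : σ → Fin N → ℚ}
    (hg : ∀ i, 0 < pairing ω (g i)) (f : MvPowerSeries σ K) : SOmega K ω :=
  (exists_substFun hω hg f).choose

theorem coeff_substFun (hω : LinearIndependent ℚ ω) {g : σ → Fin N → ℚ}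
    (hg : ∀ i, 0 < pairing ω (g i)) (f : MvPowerSeries σ K) (α : Fin N → ℚ) :
    (substFun hω hg f).1.coeff (Expo.of ω α) = ∑ d ∈ expFiber hg α, MvPowerSeries.coeff d f :=
  (exists_substFun hω hg f).choose_spec α

theorem expFiber_zero {g : σ → Fin N → ℚ} (hg : ∀ i, 0 < pairing ω (g i)) :
    expFiber hg 0 = {0} := by
  ext d
  rw [mem_expFiber, Finset.mem_singleton]
  refine ⟨fun h => ?_, fun h => by rw [h, expSum_zero]⟩
  have h1 := congrArg (pairing ω) h
  rw [pairing_expSum, pairing_zero, Finset.sum_eq_zero_iff_of_nonneg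
    (fun i _ => mul_nonneg (Nat.cast_nonneg _) (hg i).le)] at h1
  ext i
  have h2 := h1 i (Finset.mem_univ i)
  have h3 := (mul_eq_zero.1 h2).resolve_right (hg i).ne'
  exact_mod_cast h3

theorem coeff_zero_substFun (hω : LinearIndependent ℚ ω) {g : σ → Fin N → ℚ}
    (hg : ∀ i, 0 < pairing ω (g i)) (f : MvPowerSeries σ K) :
    (substFun hω hg f).1.coeff 0 = MvPowerSeries.constantCoeff f := by
  have := coeff_substFun hω hg f 0
  rw [map_zero, expFiber_zero, Finset.sum_singleton] at this
  exact this

theorem substFun_mul (hω : LinearIndependent ℚ ω) {g : σ → Fin N → ℚ}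
    (hg : ∀ i, 0 < pairing ω (g i)) (f h : MvPowerSeries σ K) :
    substFun hω hg (f * h) = substFun hω hg f * substFun hω hg h := by
  classical
  ext β
  obtain ⟨γ, rfl⟩ := (Expo.of ω).surjective β
  have hsupp : ∀ (f : MvPowerSeries σ K) (α : Fin N → ℚ),
      (substFun hω hg f).1.coeff (Expo.of ω α) ≠ 0 → ∃ d, expSum g d = α := by
    intro f α h1
    rw [coeff_substFun] at h1
    obtain ⟨d, hd, -⟩ := Finset.exists_ne_zero_of_sum_ne_zero h1
    exact ⟨d, (mem_expFiber hg).1 hd⟩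
  rw [coeff_substFun]
  change _ = ((substFun hω hg f).1 * (substFun hω hg h).1).coeff _
  simp only [MvPowerSeries.coeff_mul]
  rw [HahnSeries.coeff_mul, Finset.sum_sigma']
  set T := (expFiber hg γ).sigma fun c => Finset.HasAntidiagonal.antidiagonal c
  set q : (Σ _ : σ →₀ ℕ, (σ →₀ ℕ) × (σ →₀ ℕ)) → Expo ω × Expo ω :=
    fun x => (Expo.of ω (expSum g x.2.1), Expo.of ω (expSum g x.2.2))
  have hT : ∀ x, x ∈ T ↔ expSum g x.1 = γ ∧ x.2.1 + x.2.2 = x.1 := fun x => by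
    rw [Finset.mem_sigma, mem_expFiber, Finset.HasAntidiagonal.mem_antidiagonal]
  rw [← Finset.sum_fiberwise_of_maps_to (s := T) (t := T.image q) (g := q)
    fun x hx => Finset.mem_image_of_mem q hx]
  -- the fibre of `q` over `(α, β)` is the product of the fibres over `α` and over `β`
  have hfib : ∀ p ∈ T.image q, ∑ x ∈ T with q x = p,
      MvPowerSeries.coeff x.2.1 f * MvPowerSeries.coeff x.2.2 h =
        (substFun hω hg f).1.coeff p.1 * (substFun hω hg h).1.coeff p.2 := by
    intro p hp
    obtain ⟨y, hy, rfl⟩ := Finset.mem_image.1 hp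
    rw [hT] at hy
    rw [coeff_substFun, coeff_substFun, Finset.sum_mul_sum, ← Finset.sum_product']
    refine Finset.sum_bij' (fun x _ => x.2) (fun z _ => ⟨z.1 + z.2, z⟩) ?_ ?_ ?_ ?_ ?_
    · intro x hx
      obtain ⟨-, h2⟩ := Finset.mem_filter.1 hx
      rw [Prod.ext_iff] at h2
      rw [Finset.mem_product, mem_expFiber, mem_expFiber]
      exact ⟨(Expo.of ω).injective h2.1, (Expo.of ω).injective h2.2⟩
    · intro z hz
      rw [Finset.mem_product, mem_expFiber, mem_expFiber] at hz
      rw [Finset.mem_filter, hT]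
      refine ⟨⟨?_, rfl⟩, Prod.ext (congrArg (Expo.of ω) hz.1) (congrArg (Expo.of ω) hz.2)⟩
      rw [expSum_add, hz.1, hz.2, ← expSum_add, hy.2, hy.1]
    · intro x hx
      obtain ⟨h1, -⟩ := Finset.mem_filter.1 hx
      rw [hT] at h1
      exact Sigma.ext h1.2 HEq.rfl
    · intro z _
      rfl
    · intro x _
      rfl
  rw [Finset.sum_congr rfl hfib]
  symm
  refine Finset.sum_subset ?_ ?_
  · rintro ⟨a, b⟩ hab
    obtain ⟨ha, hb, hsum⟩ := Finset.mem_antidiagonal.1 hab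
    obtain ⟨α, rfl⟩ := (Expo.of ω).surjective a
    obtain ⟨β, rfl⟩ := (Expo.of ω).surjective b
    obtain ⟨d, rfl⟩ := hsupp f α ha
    obtain ⟨e, rfl⟩ := hsupp h β hb
    refine Finset.mem_image.2 ⟨⟨d + e, d, e⟩, (hT _).2 ⟨?_, rfl⟩, rfl⟩
    rw [expSum_add]
    exact (Expo.of ω).injective hsum
  · intro p hp hnot
    by_contra h0
    refine hnot (Finset.mem_antidiagonal.2
      ⟨left_ne_zero_of_mul h0, right_ne_zero_of_mul h0, ?_⟩)
    obtain ⟨x, hx, rfl⟩ := Finset.mem_image.1 hp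
    rw [hT] at hx
    change Expo.of ω (expSum g x.2.1) + Expo.of ω (expSum g x.2.2) = _
    rw [← map_add, ← expSum_add, hx.2, hx.1]

/-- The substitution `X_i ↦ x^(g_i)`, where the `g_i` have positive weight, is a ring homomorphism
from power series to `S_ω`. -/
def substHom (hω : LinearIndependent ℚ ω) {g : σ → Fin N → ℚ}
    (hg : ∀ i, 0 < pairing ω (g i)) : MvPowerSeries σ K →+* SOmega K ω where
  toFun := substFun hω hg
  map_mul' := substFun_mul hω hg
  map_zero' := by
    ext β
    obtain ⟨γ, rfl⟩ := (Expo.of ω).surjective β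
    rw [coeff_substFun]
    exact Finset.sum_eq_zero fun d _ => map_zero _
  map_add' f h := by
    ext β
    obtain ⟨γ, rfl⟩ := (Expo.of ω).surjective β
    change _ = (substFun hω hg f).1.coeff _ + (substFun hω hg h).1.coeff _
    rw [coeff_substFun, coeff_substFun, coeff_substFun, ← Finset.sum_add_distrib]
    exact Finset.sum_congr rfl fun d _ => map_add _ _ _
  map_one' := by
    classical
    ext β
    obtain ⟨γ, rfl⟩ := (Expo.of ω).surjective β
    rw [coeff_substFun, ← mono_zero_one, coeff_mono, EmbeddingLike.apply_eq_iff_eq]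
    simp only [MvPowerSeries.coeff_one]
    rw [Finset.sum_ite_eq']
    simp only [mem_expFiber, expSum_zero, eq_comm]
    split_ifs <;> rfl

theorem coeff_zero_substHom (hω : LinearIndependent ℚ ω) {g : σ → Fin N → ℚ}
    (hg : ∀ i, 0 < pairing ω (g i)) (f : MvPowerSeries σ K) :
    (substHom hω hg f).1.coeff 0 = MvPowerSeries.constantCoeff f :=
  coeff_zero_substFun hω hg f

theorem exists_substHom_eq (hω : LinearIndependent ℚ ω) {g : σ → Fin N → ℚ}
    (hg : ∀ i, 0 < pairing ω (g i)) {s : SOmega K ω}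
    (hs : ∀ α, s.1.coeff (Expo.of ω α) ≠ 0 → α ∈ Set.range (expSum g)) :
    ∃ f, substHom hω hg f = s := by
  classical
  -- among the monomials with image `x^α`, one is chosen to carry the coefficient of `x^α`
  set r : (Fin N → ℚ) → (σ →₀ ℕ) := Function.invFun (expSum g)
  set f : MvPowerSeries σ K := fun d =>
    if r (expSum g d) = d then s.1.coeff (Expo.of ω (expSum g d)) else 0
  have hf : ∀ d, MvPowerSeries.coeff d f =
      if r (expSum g d) = d then s.1.coeff (Expo.of ω (expSum g d)) else 0 := fun d => rfl
  refine ⟨f, ?_⟩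
  ext β
  obtain ⟨α, rfl⟩ := (Expo.of ω).surjective β
  change (substFun hω hg f).1.coeff _ = _
  rw [coeff_substFun]
  have h1 : ∀ d ∈ expFiber hg α, MvPowerSeries.coeff d f =
      if r α = d then s.1.coeff (Expo.of ω α) else 0 := by
    intro d hd
    rw [mem_expFiber] at hd
    rw [hf, hd]
  rw [Finset.sum_congr rfl h1, Finset.sum_ite_eq]
  simp only [mem_expFiber]
  split_ifs with h2
  · rfl
  · by_contra h0
    obtain ⟨d, hd⟩ := hs α (Ne.symm h0)
    exact h2 (Function.invFun_eq ⟨d, hd⟩)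

theorem mem_range_expSum {G : Finset (Fin N → ℚ)} {α : Fin N → ℚ}
    (h : α ∈ AddSubmonoid.closure (G : Set (Fin N → ℚ))) :
    α ∈ Set.range (expSum fun v : G => (v : Fin N → ℚ)) := by
  induction h using AddSubmonoid.closure_induction with
  | mem v hv =>
    classical
    refine ⟨Finsupp.single ⟨v, hv⟩ 1, ?_⟩
    rw [expSum, Finset.sum_eq_single ⟨v, hv⟩]
    · simp
    · intro w _ hw
      rw [Finsupp.single_eq_of_ne hw, zero_smul]
    · simp
  | zero => exact ⟨0, expSum_zero _⟩
  | add _ _ _ _ hx hy =>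
    obtain ⟨d, rfl⟩ := hx
    obtain ⟨e, rfl⟩ := hy
    exact ⟨d + e, expSum_add _ _ _⟩

/-- Finitely many series of nonnegative weight all come from power series under one substitution of
monomials of positive weight. -/
theorem exists_substHom_of_finset (hω : LinearIndependent ℚ ω) (F : Finset (SOmega K ω))
    (hF : ∀ s ∈ F, s ∈ geSub K ω 0) :
    ∃ (G : Finset (Fin N → ℚ)) (hG : ∀ v : G, 0 < pairing ω (v : Fin N → ℚ)),
      ∀ s ∈ F, ∃ f : MvPowerSeries G K, substHom hω hG f = s := by
  classical
  choose G hG hG' using fun s : SOmega K ω => IsPositivePuiseux.exists_generators hω s.2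
  refine ⟨F.biUnion G, fun v => ?_, fun s hs => exists_substHom_eq hω _ fun α hα => ?_⟩
  · obtain ⟨s, -, h⟩ := Finset.mem_biUnion.1 v.2
    exact hG s _ h
  · refine mem_range_expSum (AddSubmonoid.closure_mono ?_ (hG' s α hα
      (WithTop.coe_le_coe.1 (hF s hs _ hα))))
    exact_mod_cast Finset.subset_biUnion_of_mem G hs

end Generators

/-! ### Factorization over complete local rings -/

section CompleteLocal

/-- A polynomial over a complete local ring whose reduction vanishes to order exactly `m` at `0`
has a monic factor of degree `m`, namely the distinguished polynomial of Weierstrass preparation. -/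
theorem exists_monic_dvd_of_isUnit_coeff {A : Type*} [CommRing A] [IsLocalRing A]
    [IsAdicComplete (IsLocalRing.maximalIdeal A) A] {P : Polynomial A} {m : ℕ}
    (hm : IsUnit (P.coeff m)) (hlt : ∀ i < m, ¬ IsUnit (P.coeff i)) :
    ∃ W : Polynomial A, W.Monic ∧ W.natDegree = m ∧ W ∣ P := by
  set g : PowerSeries A := (P : PowerSeries A)
  have hcoeff : ∀ i, PowerSeries.coeff i (g.map (IsLocalRing.residue A)) =
      IsLocalRing.residue A (P.coeff i) := fun i => by
    rw [PowerSeries.coeff_map, Polynomial.coeff_coe]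
  have hm' : PowerSeries.coeff m (g.map (IsLocalRing.residue A)) ≠ 0 := by
    rw [hcoeff]
    exact (hm.map _).ne_zero
  have hg : g.map (IsLocalRing.residue A) ≠ 0 := fun h => hm' (by rw [h, map_zero])
  have hord : (g.map (IsLocalRing.residue A)).order = m := by
    rw [PowerSeries.order_eq_nat]
    refine ⟨hm', fun i hi => ?_⟩
    rw [hcoeff, IsLocalRing.residue_eq_zero_iff]
    exact hlt i hi
  obtain ⟨W, h, H⟩ := PowerSeries.exists_isWeierstrassFactorization hg
  refine ⟨W, H.isDistinguishedAt.monic, ?_, ?_⟩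
  · rw [H.natDegree_eq_toNat_order_map, hord]
    rfl
  · -- uniqueness of Weierstrass division by `W` identifies the two ways to divide `P` by `W`
    have hW := H.isDistinguishedAt
    have h0 := hW.isWeierstrassDivisorAt'
    have hdeg : (P %ₘ W).degree <
        ((W : PowerSeries A).map (Ideal.Quotient.mk (IsLocalRing.maximalIdeal A))).order.toNat := by
      have h1 := hW.degree_eq_coe_lift_order_map (W : PowerSeries A) 1
        (by rw [PowerSeries.constantCoeff_one, ← Ideal.ne_top_iff_one]
            exact Ideal.IsPrime.ne_top') (by simp)
      rw [ENat.lift_eq_toNat_of_lt_top] at h1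
      rw [← h1]
      exact Polynomial.degree_modByMonic_lt P hW.monic
    have h2 := h0.eq_of_mul_add_eq_mul_add (q := ((P /ₘ W : Polynomial A) : PowerSeries A))
      (q' := h) (r := P %ₘ W) (r' := 0) hdeg (by rw [Polynomial.degree_zero]; exact WithBot.bot_lt_coe _)
      (by
        rw [← H.eq_mul, Polynomial.coe_zero, add_zero, ← Polynomial.coe_mul, ← Polynomial.coe_add,
          add_comm, Polynomial.modByMonic_add_div])
    exact (Polynomial.modByMonic_eq_zero_iff_dvd hW.monic).1 h2.2

theorem maximalIdeal_mvPowerSeries {σ : Type*} [Finite σ] :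
    IsLocalRing.maximalIdeal (MvPowerSeries σ K) = Ideal.span (Set.range MvPowerSeries.X) := by
  classical
  cases nonempty_fintype σ
  ext f
  rw [IsLocalRing.mem_maximalIdeal, mem_nonunits_iff, MvPowerSeries.isUnit_iff_constantCoeff,
    isUnit_iff_ne_zero, not_not]
  constructor
  · intro hf
    -- every monomial `X^d ≠ 1` of `f` is attributed to a variable dividing it
    have hsel : ∀ d : σ →₀ ℕ, ∃ i : Option σ, d ≠ 0 → ∃ j, i = some j ∧ d j ≠ 0 := by
      intro d
      by_cases hd : d = 0
      · exact ⟨none, fun h => absurd hd h⟩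
      · obtain ⟨j, hj⟩ := Finsupp.ne_iff.1 hd
        exact ⟨some j, fun _ => ⟨j, rfl, hj⟩⟩
    choose sel hsel using hsel
    set u : σ → MvPowerSeries σ K := fun i d =>
      if sel (d + Finsupp.single i 1) = some i then
        MvPowerSeries.coeff (d + Finsupp.single i 1) f else 0
    have hu : ∀ i d, MvPowerSeries.coeff d (u i) = if sel (d + Finsupp.single i 1) = some i then
        MvPowerSeries.coeff (d + Finsupp.single i 1) f else 0 := fun _ _ => rfl
    have : f = ∑ i, MvPowerSeries.X i * u i := by
      ext d
      rw [map_sum]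
      simp only [MvPowerSeries.X, MvPowerSeries.coeff_monomial_mul, one_mul, hu]
      by_cases hd : d = 0
      · subst hd
        rw [MvPowerSeries.coeff_zero_eq_constantCoeff_apply, hf]
        refine (Finset.sum_eq_zero fun i _ => if_neg fun h => ?_).symm
        have := h i
        simp at this
      · obtain ⟨j, hj, hdj⟩ := hsel d hd
        rw [Finset.sum_eq_single j]
        · have hle : Finsupp.single j 1 ≤ d := by
            rw [Finsupp.single_le_iff]
            exact Nat.one_le_iff_ne_zero.2 hdj
          rw [if_pos hle, tsub_add_cancel_of_le hle, if_pos hj]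
        · intro i _ hij
          split_ifs with h1 h2
          · rw [tsub_add_cancel_of_le h1, hj] at h2
            exact absurd (Option.some.inj h2).symm hij
          · rfl
          · rfl
        · simp
    rw [this]
    exact sum_mem fun i _ => Ideal.mul_mem_right _ _ (Ideal.subset_span ⟨i, rfl⟩)
  · intro hf
    have : Ideal.span (Set.range MvPowerSeries.X) ≤
        RingHom.ker (MvPowerSeries.constantCoeff (σ := σ) (R := K)) := by
      rw [Ideal.span_le]
      rintro _ ⟨i, rfl⟩
      exact MvPowerSeries.constantCoeff_X i
    exact this hf

instance isAdicComplete_mvPowerSeries {σ : Type*} [Finite σ] :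
    IsAdicComplete (IsLocalRing.maximalIdeal (MvPowerSeries σ K)) (MvPowerSeries σ K) := by
  rw [maximalIdeal_mvPowerSeries]
  infer_instance

end CompleteLocal

/-! ### The field of series is algebraically closed -/

section AlgClosed

open Polynomial

theorem coeff_taylor_of_natDegree_eq {R : Type*} [CommRing R] {P : R[X]} {n : ℕ}
    (hP : P.Monic) (hn : P.natDegree = n + 1) (r : R) :
    (taylor r P).coeff n = P.coeff n + (n + 1) * r := by
  nontriviality R
  rw [taylor_coeff, eval_eq_sum_range' (n := 2)]
  · have h1 : P.coeff (1 + n) = 1 := by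
      rw [add_comm, ← hn]
      exact hP
    simp only [Finset.sum_range_succ, Finset.sum_range_zero, hasseDeriv_coeff, h1, zero_add,
      Nat.choose_self, pow_zero, pow_one, mul_one, Nat.cast_one, one_mul]
    rw [add_comm 1 n, Nat.choose_succ_self_right]
    push_cast
    ring
  · refine (natDegree_hasseDeriv_le P n).trans_lt ?_
    omega

/-- A monic polynomial of degree `n` without term of degree `n - 1`, other than `X^n`, has a root
of multiplicity less than `n`. -/
theorem exists_taylor_coeff [IsAlgClosed K] [CharZero K] {p : K[X]} {n : ℕ} (hp : p.Monic)
    (hn : p.natDegree = n + 1) (h0 : p.coeff n = 0) (h1 : ∃ i < n + 1, p.coeff i ≠ 0) :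
    ∃ (c : K) (m : ℕ), 0 < m ∧ m < n + 1 ∧ (taylor c p).coeff m ≠ 0 ∧
      ∀ i < m, (taylor c p).coeff i = 0 := by
  obtain ⟨c, hc⟩ := IsAlgClosed.exists_root p (by
    rw [degree_eq_natDegree hp.ne_zero, hn]
    exact_mod_cast n.succ_ne_zero)
  have hq : taylor c p ≠ 0 := fun h => hp.ne_zero ((taylor_eq_zero c p).1 h)
  have hlow : ∀ i < (taylor c p).natTrailingDegree, (taylor c p).coeff i = 0 := fun i hi =>
    coeff_eq_zero_of_lt_natTrailingDegree hi
  have htop : (taylor c p).coeff (taylor c p).natTrailingDegree ≠ 0 :=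
    mt trailingCoeff_eq_zero.1 hq
  refine ⟨c, (taylor c p).natTrailingDegree, Nat.pos_of_ne_zero fun h => htop ?_, ?_, htop, hlow⟩
  · rw [h, taylor_coeff_zero]
    exact hc
  · refine lt_of_le_of_ne ?_ fun h => ?_
    · rw [← hn, ← natDegree_taylor p c]
      exact natTrailingDegree_le_natDegree _
    · -- otherwise `p = (X - c)^(n+1)`, whose coefficient of degree `n` is `-(n+1)c`
      rw [h] at hlow
      have h2 := hlow n n.lt_succ_self
      rw [coeff_taylor_of_natDegree_eq hp hn, h0, zero_add] at h2
      have hc0 : c = 0 := (mul_eq_zero.1 h2).resolve_left (by exact_mod_cast n.succ_ne_zero)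
      obtain ⟨i, hi, hi'⟩ := h1
      have := hlow i hi
      rw [hc0, taylor_zero] at this
      exact hi' this

/-- A monic polynomial over a power series ring whose reduction has no term of degree `n - 1` and
is not `X^n` has, up to translation, a monic factor of smaller positive degree. -/
theorem exists_monic_dvd_taylor [IsAlgClosed K] [CharZero K] {σ : Type*} [Finite σ]
    {P : (MvPowerSeries σ K)[X]} {n : ℕ} (hP : P.Monic) (hn : P.natDegree = n + 1)
    (h0 : MvPowerSeries.constantCoeff (P.coeff n) = 0)
    (h1 : ∃ i < n + 1, MvPowerSeries.constantCoeff (P.coeff i) ≠ 0) :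
    ∃ (c : MvPowerSeries σ K) (W : (MvPowerSeries σ K)[X]),
      W.Monic ∧ 0 < W.natDegree ∧ W.natDegree < n + 1 ∧ W ∣ taylor c P := by
  set ρ := MvPowerSeries.constantCoeff (σ := σ) (R := K)
  obtain ⟨c, m, hm0, hmn, hm, hlow⟩ := exists_taylor_coeff (p := P.map ρ) (hP.map ρ)
    (by rw [hP.natDegree_map, hn]) (by rw [coeff_map, h0])
    (h1.imp fun i hi => ⟨hi.1, by rw [coeff_map]; exact hi.2⟩)
  have hρ : ∀ i, ρ ((taylor (MvPowerSeries.C c) P).coeff i) = (taylor c (P.map ρ)).coeff i := by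
    intro i
    rw [← coeff_map, map_taylor, MvPowerSeries.constantCoeff_C]
  obtain ⟨W, hW, hWm, hdvd⟩ := exists_monic_dvd_of_isUnit_coeff
    (P := taylor (MvPowerSeries.C c) P) (m := m)
    (by rw [MvPowerSeries.isUnit_iff_constantCoeff, hρ]; exact hm.isUnit)
    (fun i hi => by
      rw [MvPowerSeries.isUnit_iff_constantCoeff, hρ, hlow i hi]
      exact not_isUnit_zero)
  exact ⟨_, W, hW, hWm ▸ hm0, hWm ▸ hmn, hdvd⟩

variable {ω : Fin N → ℝ}

theorem isUnit_mono (a : Fin N → ℚ) {c : K} (hc : c ≠ 0) : IsUnit (mono ω a c) := by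
  refine IsUnit.of_mul_eq_one (mono ω (-a) c⁻¹) ?_
  rw [mono_mul_mono, add_neg_cancel, mul_inv_cancel₀ hc, mono_zero_one]

/-- Multiplication by a monomial turns a nonzero series into one with nonzero constant term and only
nonnegative weights, which is the image of an invertible power series. -/
theorem isUnit_of_ne_zero (hω : LinearIndependent ℚ ω) {s : SOmega K ω} (hs : s ≠ 0) :
    IsUnit s := by
  obtain ⟨α, hα, hge, -⟩ := exists_leading hs
  set a := (Expo.of ω).symm α
  have ha : Expo.of ω (-a) = -α := by simp [a]
  have ht : mono ω (-a) (1 : K) * s ∈ geSub K ω 0 := by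
    have h1 := mul_mem_geSub (m := ((-α).wt : ℝ)) (mono_mem_weightSub (a := -a)
      (S := Set.Ici (((-α).wt : ℝ) : WithTop ℝ)) (by rw [ha]; exact Set.self_mem_Ici) (1 : K)) hge
    rwa [← WithTop.coe_add, Expo.wt_neg, neg_add_cancel, WithTop.coe_zero] at h1
  have h0 : (mono ω (-a) (1 : K) * s).1.coeff 0 ≠ 0 := by
    rw [coeff_mono_mul', ha, zero_sub, neg_neg]
    exact mul_ne_zero one_ne_zero hα
  obtain ⟨G, hG, h⟩ := exists_substHom_of_finset hω {mono ω (-a) (1 : K) * s} (by simpa)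
  obtain ⟨f, hf⟩ := h _ (Finset.mem_singleton_self _)
  rw [← hf, coeff_zero_substHom] at h0
  have hfu : IsUnit f := MvPowerSeries.isUnit_iff_constantCoeff.2 h0.isUnit
  have := hfu.map (substHom hω hG)
  rw [hf] at this
  exact isUnit_of_mul_isUnit_right this

/-- A monic polynomial with coefficients of nonnegative weight has, up to translation, a monic
factor of smaller positive degree, if its reduction has no term of degree `n - 1` and is not
`X^n`. -/
theorem exists_monic_dvd_taylor_of_geSub [IsAlgClosed K] [CharZero K]
    (hω : LinearIndependent ℚ ω) {P : (SOmega K ω)[X]} {n : ℕ} (hP : P.Monic)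
    (hn : P.natDegree = n + 1) (hge : ∀ i, P.coeff i ∈ geSub K ω 0) (h0 : P.coeff n = 0)
    (h1 : ∃ i < n + 1, (P.coeff i).1.coeff 0 ≠ 0) :
    ∃ (c : SOmega K ω) (W : (SOmega K ω)[X]),
      W.Monic ∧ 0 < W.natDegree ∧ W.natDegree < n + 1 ∧ W ∣ taylor c P := by
  classical
  have := nontrivial_SOmega (K := K) (ω := ω)
  obtain ⟨G, hG, hlift⟩ := exists_substHom_of_finset hω
    (insert 0 (P.support.image P.coeff)) (by
      simp only [Finset.mem_insert, Finset.mem_image]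
      rintro s (rfl | ⟨i, -, rfl⟩)
      exacts [zero_mem _, hge i])
  have hlifts : P ∈ lifts (substHom hω hG) := by
    rw [lifts_iff_coeff_lifts]
    intro i
    refine hlift _ ?_
    by_cases hi : P.coeff i = 0
    · simp [hi]
    · exact Finset.mem_insert_of_mem (Finset.mem_image_of_mem _ (mem_support_iff.2 hi))
  obtain ⟨Q, rfl, hQn, hQ⟩ := lifts_and_natDegree_eq_and_monic hlifts hP
  simp only [coeff_map, coeff_zero_substHom] at h0 h1
  obtain ⟨c, W, hW, hW0, hWn, hdvd⟩ := exists_monic_dvd_taylor hQ (hQn.trans hn)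
    (by rw [← coeff_zero_substHom hω hG, h0]; rfl) h1
  refine ⟨substHom hω hG c, W.map (substHom hω hG), hW.map _, ?_, ?_, ?_⟩
  · rwa [hW.natDegree_map]
  · rwa [hW.natDegree_map]
  · rw [← map_taylor]
    exact map_dvd (mapRingHom _) hdvd

/-- Rescaling the variable by a monomial makes the first edge of the Newton polygon
horizontal: all weights become nonnegative, and weight `0` is attained below the top degree. -/
theorem exists_scaleRoots_mem_geSub {P : (SOmega K ω)[X]} {n : ℕ} (hP : P.Monic)
    (hn : P.natDegree = n) (h1 : ∃ i < n, P.coeff i ≠ 0) :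
    ∃ a : Fin N → ℚ, (∀ i, (scaleRoots P (mono ω a 1)).coeff i ∈ geSub K ω 0) ∧
      ∃ i < n, ((scaleRoots P (mono ω a 1)).coeff i).1.coeff 0 ≠ 0 := by
  classical
  have hlead : ∀ i, ∃ α : Expo ω, P.coeff i ≠ 0 →
      (P.coeff i).1.coeff α ≠ 0 ∧ P.coeff i ∈ geSub K ω α.wt := by
    intro i
    by_cases h : P.coeff i = 0
    · exact ⟨0, fun h' => absurd h h'⟩
    · obtain ⟨α, h2, h3, -⟩ := exists_leading h
      exact ⟨α, fun _ => ⟨h2, h3⟩⟩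
  choose α hα using hlead
  obtain ⟨i₀, hi₀, hmin⟩ := ((Finset.range n).filter fun i => P.coeff i ≠ 0).exists_min_image
    (fun i => (α i).wt / ((n - i : ℕ) : ℝ))
    (h1.imp fun i hi => Finset.mem_filter.2 ⟨Finset.mem_range.2 hi.1, hi.2⟩)
  obtain ⟨hi₀n, hi₀⟩ := Finset.mem_filter.1 hi₀
  rw [Finset.mem_range] at hi₀n
  have hpos : ∀ i < n, (0 : ℝ) < ((n - i : ℕ) : ℝ) := fun i hi => by
    exact_mod_cast Nat.sub_pos_of_lt hi
  -- minus the least slope `α_i / (n - i)` of the Newton polygon, as an exponent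
  set a : Fin N → ℚ := -(((n - i₀ : ℕ) : ℚ)⁻¹ • (Expo.of ω).symm (α i₀))
  have hsmul : ∀ k : ℕ, (Expo.of ω (k • a)).wt =
      -(k * ((α i₀).wt / ((n - i₀ : ℕ) : ℝ))) := by
    intro k
    change pairing ω (k • a) = -(k * (pairing ω ((Expo.of ω).symm (α i₀)) / _))
    simp only [pairing, a, Finset.sum_div, Finset.mul_sum, ← Finset.sum_neg_distrib]
    refine Finset.sum_congr rfl fun i _ => ?_
    simp only [Pi.smul_apply, Pi.neg_apply, smul_eq_mul, nsmul_eq_mul]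
    push_cast
    ring
  have hi₀a : Expo.of ω ((n - i₀) • a) = -(α i₀) := by
    have h2 : ((n - i₀ : ℕ) : ℚ) ≠ 0 := by exact_mod_cast (Nat.sub_pos_of_lt hi₀n).ne'
    have h3 : (n - i₀) • a = -(Expo.of ω).symm (α i₀) := by
      rw [smul_neg, ← Nat.cast_smul_eq_nsmul ℚ, smul_smul, mul_inv_cancel₀ h2, one_smul]
    rw [h3, map_neg, AddEquiv.apply_symm_apply]
  refine ⟨a, fun i => ?_, i₀, hi₀n, ?_⟩
  · rw [coeff_scaleRoots, hn, mono_pow, mul_comm]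
    by_cases hi : P.coeff i = 0
    · rw [hi, mul_zero]
      exact zero_mem _
    have h2 := mul_mem_geSub (m := ((Expo.of ω ((n - i) • a)).wt : ℝ))
      (mono_mem_weightSub (S := Set.Ici _) Set.self_mem_Ici (1 : K)) (hα i hi).2
    refine fun β hβ => Set.mem_Ici.2 (le_trans ?_ (Set.mem_Ici.1 (h2 β hβ)))
    rw [← WithTop.coe_add, ← WithTop.coe_zero, WithTop.coe_le_coe, hsmul]
    rcases lt_trichotomy i n with hin | rfl | hin
    · have h3 := hmin i (Finset.mem_filter.2 ⟨Finset.mem_range.2 hin, hi⟩)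
      rw [le_div_iff₀ (hpos i hin)] at h3
      linarith
    · -- the leading coefficient is `1`, of weight `0`
      have h3 : (α i).wt = 0 := by
        have h4 := (hα i hi).1
        rw [← hn, hP.coeff_natDegree, hn, ← mono_zero_one, coeff_mono] at h4
        have h5 : α i = Expo.of ω 0 := by
          by_contra h
          exact h4 (if_neg h)
        rw [h5, map_zero, Expo.wt_zero]
      simp [h3]
    · exact absurd (coeff_eq_zero_of_natDegree_lt (hn.trans_lt hin)) hi
  · rw [coeff_scaleRoots, hn, mono_pow, mul_comm, coeff_mono_mul', hi₀a, zero_sub, neg_neg, one_mul]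
    exact (hα i₀ hi₀).1

/-- The Newton-Puiseux algorithm: after removing the term of degree `n - 1` and rescaling, either
the polynomial is `X^n`, or it factors properly. -/
theorem exists_root_of_monic [IsAlgClosed K] [CharZero K] (hω : LinearIndependent ℚ ω) (n : ℕ)
    {P : (SOmega K ω)[X]} (hP : P.Monic) (hn : P.natDegree = n + 1) : ∃ z, P.eval z = 0 := by
  have := nontrivial_SOmega (K := K) (ω := ω)
  induction n using Nat.strong_induction_on generalizing P with
  | _ n ih =>
  set r : SOmega K ω := -((((n : K) + 1)⁻¹) • P.coeff n)
  have hr : ((n : SOmega K ω) + 1) * r = -P.coeff n := by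
    have h1 : (n : K) + 1 ≠ 0 := by exact_mod_cast n.succ_ne_zero
    have h2 : (n : SOmega K ω) + 1 = algebraMap K _ ((n : K) + 1) := by simp
    rw [h2, ← Algebra.smul_def, smul_neg, smul_smul, mul_inv_cancel₀ h1, one_smul]
  set Q := taylor r P
  have hQn : Q.natDegree = n + 1 := (natDegree_taylor P r).trans hn
  have hQ : Q.Monic := (leadingCoeff_taylor r P).trans hP
  have hQ0 : Q.coeff n = 0 := by
    rw [coeff_taylor_of_natDegree_eq hP hn, hr, add_neg_cancel]
  suffices ∃ z, Q.eval z = 0 by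
    obtain ⟨z, hz⟩ := this
    exact ⟨z + r, by rw [← taylor_eval]; exact hz⟩
  by_cases h1 : ∃ i < n + 1, Q.coeff i ≠ 0
  · obtain ⟨a, hge, hne⟩ := exists_scaleRoots_mem_geSub hQ hQn h1
    set s := mono ω a (1 : K)
    obtain ⟨c, W, hW, hW0, hWn, hdvd⟩ := exists_monic_dvd_taylor_of_geSub hω
      ((monic_scaleRoots_iff s).2 hQ) ((natDegree_scaleRoots Q s).trans hQn) hge
      (by rw [coeff_scaleRoots, hQ0, zero_mul]) hne
    obtain ⟨z, hz⟩ := ih (W.natDegree - 1) (by omega) hW (by omega)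
    have hz' := eval_eq_zero_of_dvd_of_eval_eq_zero hdvd hz
    rw [taylor_eval] at hz'
    obtain ⟨t, ht⟩ := (isUnit_mono (ω := ω) a (one_ne_zero (α := K))).exists_right_inv
    refine ⟨t * (z + c), ?_⟩
    have h2 := scaleRoots_eval_mul Q (t * (z + c)) s
    rw [← mul_assoc, ht, one_mul, hz'] at h2
    exact (((isUnit_mono a one_ne_zero).pow _).mul_right_eq_zero).1 h2.symm
  · push Not at h1
    refine ⟨0, ?_⟩
    rw [← coeff_zero_eq_eval_zero]
    exact h1 0 n.succ_pos

end AlgClosed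

/-! ### Solutions with a prescribed first term -/

section Solutions

/-- Hilbert's Nullstellensatz over a commutative ring that is an algebraically closed field. -/
theorem exists_pow_mem_of_eval_eq_zero {R σ : Type*} [CommRing R] [Nontrivial R] [Finite σ]
    (hR : ∀ s : R, s ≠ 0 → IsUnit s)
    (hroot : ∀ (n : ℕ) (P : Polynomial R), P.Monic → P.natDegree = n + 1 → ∃ z, P.eval z = 0)
    {J : Ideal (MvPolynomial σ R)} {F : MvPolynomial σ R}
    (h : ∀ x : σ → R, (∀ f ∈ J, MvPolynomial.eval x f = 0) → MvPolynomial.eval x F = 0) :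
    ∃ n, F ^ n ∈ J := by
  let : Field R := IsField.toField
    ⟨exists_pair_ne R, mul_comm, fun h => (hR _ h).exists_right_inv⟩
  have : IsAlgClosed R := IsAlgClosed.of_exists_root _ fun P hP hirr => by
    have := hirr.natDegree_pos
    exact hroot (P.natDegree - 1) P hP (by omega)
  have h1 : F ∈ MvPolynomial.vanishingIdeal R (MvPolynomial.zeroLocus R J) := by
    rw [MvPolynomial.mem_vanishingIdeal_iff]
    intro x hx
    rw [MvPolynomial.aeval_eq_eval]
    refine h x fun f hf => ?_
    have := MvPolynomial.mem_zeroLocus_iff.1 hx f hf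
    rwa [MvPolynomial.aeval_eq_eval] at this
  rw [MvPolynomial.vanishingIdeal_zeroLocus_eq_radical] at h1
  exact h1

/-- A submonoid of polynomials that contains, for each of the finitely many zeros of an ideal, some
polynomial vanishing there, meets the ideal. -/
theorem exists_mem_submonoid_of_finite {R σ : Type*} [CommRing R] [Nontrivial R] [Finite σ]
    (hR : ∀ s : R, s ≠ 0 → IsUnit s)
    (hroot : ∀ (n : ℕ) (P : Polynomial R), P.Monic → P.natDegree = n + 1 → ∃ z, P.eval z = 0)
    {J : Ideal (MvPolynomial σ R)}
    (hfin : {x : σ → R | ∀ f ∈ J, MvPolynomial.eval x f = 0}.Finite)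
    (T : Submonoid (MvPolynomial σ R))
    (hT : ∀ x : σ → R, (∀ f ∈ J, MvPolynomial.eval x f = 0) →
      ∃ G ∈ T, MvPolynomial.eval x G = 0) : ∃ F ∈ T, F ∈ J := by
  classical
  have hG : ∀ x : σ → R, ∃ G ∈ T,
      (∀ f ∈ J, MvPolynomial.eval x f = 0) → MvPolynomial.eval x G = 0 := by
    intro x
    by_cases hx : ∀ f ∈ J, MvPolynomial.eval x f = 0
    · obtain ⟨G, hG, h⟩ := hT x hx
      exact ⟨G, hG, fun _ => h⟩
    · exact ⟨1, T.one_mem, fun h => absurd h hx⟩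
  choose G hGT hG using hG
  obtain ⟨n, hn⟩ := exists_pow_mem_of_eval_eq_zero hR hroot (J := J)
    (F := ∏ x ∈ hfin.toFinset, G x) fun x hx => by
      rw [map_prod]
      exact Finset.prod_eq_zero (hfin.mem_toFinset.2 hx) (hG x hx)
  exact ⟨_, pow_mem (prod_mem fun x _ => hGT x) n, hn⟩

theorem eval_X_sub_C_self {R σ : Type*} [CommRing R] (x : σ → R) (j : σ) :
    MvPolynomial.eval x (MvPolynomial.X j - MvPolynomial.C (x j)) = 0 := by simp

/-- If no solution starts with `φ`, every one of the finitely many solutions `p` has a coordinate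
`p_j` whose first term is not `φ_j`. A product of powers of the corresponding `y_j - p_j` then lies
in the extended ideal; but these factors attain their order at `φ`, whereas no element of the
extended ideal does. -/
theorem exists_isSolution_inser_eq [IsAlgClosed K] [CharZero K] {ω : Fin N → ℝ}
    (hω : LinearIndependent ℚ ω) {I : Ideal (LaurentPoly K N M)} (hI : IsAdmissible I)
    {c : Fin M → K} {a : Fin M → Fin N → ℚ}
    (h : IsSolution (initialIdeal ω (fun j => ordser (mono ω (a j) (c j))) I)
      fun j => mono ω (a j) (c j)) :
    ∃ ψ : Fin M → SOmega K ω, IsSolution I ψ ∧ ∀ j, inser (ψ j) = mono ω (a j) (c j) := by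
  by_contra! hne
  have := nontrivial_SOmega (K := K) (ω := ω)
  obtain ⟨F, hF, hFI⟩ := exists_mem_submonoid_of_finite (fun _ => isUnit_of_ne_zero hω)
    (fun n _ => exists_root_of_monic hω n) (finite_setOf_isSolution hω hI)
    (regularAt hω (fun j => ordser (mono ω (a j) (c j))) (fun j => mono ω (a j) (c j))
      fun _ => mono_mem_weightSub_ordser Set.self_mem_Ici) fun ψ hψ =>
        (hne ψ hψ).elim fun j hj => ⟨_, X_sub_C_mem_regularAt hω hj, eval_X_sub_C_self ψ j⟩
  exact notMem_regularAt hω _ h hFI hF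

end Solutions

end OmegaPuiseux

end

open OmegaPuiseux in
theorem mainTheorem1 {K : Type*} [Field K] [IsAlgClosed K] [CharZero K] {N M : ℕ}
    (I : Ideal (LaurentPoly K N M)) (hI : IsAdmissible I)
    (ω : Fin N → ℝ) (hω : LinearIndependent ℚ ω)
    (c : Fin M → K) (α : Fin M → Fin N → ℚ)
    (φ : Fin M → SOmega K ω) (hφ : φ = fun j => mono ω (α j) (c j)) :
    (∃ ψ : Fin M → SOmega K ω, IsSolution I ψ ∧ (fun j => inser (ψ j)) = φ) ↔
      (ω, fun j => ordser (φ j)) ∈ tropicalVariety I ∧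
        IsSolution (initialIdeal ω (fun j => ordser (φ j)) I) φ := by
  subst hφ
  constructor
  · rintro ⟨ψ, hψ, h⟩
    have hsol := isSolution_initialIdeal hω hψ fun j => congrFun h j
    exact ⟨mem_tropicalVariety hω hsol, hsol⟩
  · rintro ⟨-, hsol⟩
    obtain ⟨ψ, hψ, h⟩ := exists_isSolution_inser_eq hω hI hsol
    exact ⟨ψ, hψ, funext h⟩
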